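/- Let $\lambda>\mu>0$. For $x\ge 0$ consider the telegraph motion on $\mathbb{R}$ which starts at $x$, moves with unit speed, initially upwards, and alternates its direction, the successive upward and downward periods being independent, the upward ones exponential with rate $\lambda$ and the downward ones exponential with rate $\mu$. For $x>0$ let $C_x$ be the first time at which the motion started at $x$ is at the origin, and let $C_{0,1},C_{0,2},\dots$ be i.i.d. copies of the first strictly positive time at which the motion started at $0$ is at the origin. Let $M$ be a random variable with values in $\{1,2,\dots\}$ such that $\mathbb{E}[e^{sM}]<\infty$ for some $s>0$, with $C_x$, $M$, $C_{0,1},C_{0,2},\dots$ independent, and let $$A_x=C_x+1_{\{M>1\}}\sum_{i=1}^{M-1}C_{0,i}$$ be the absorption time at the origin (the particle restarts upwards at each visit of the origin and is absorbed at the $M$-th one). Put $$\Lambda(s;\lambda,\mu)=\frac{\lambda-\mu-\sqrt{(\lambda+\mu-2s)^2-4\lambda\mu}}{2},$$ and let $\Lambda''$ be its second derivative with respect to $s$. Then $\mathbb{E}[A_x]$ is finite for every $x>0$ and, for every family of positive numbers $\{\varepsilon_x:x>0\}$ such that $\varepsilon_x\to0$ and $x\varepsilon_x\to\infty$ as $x\to\infty$,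 the family $$Z_x=\frac{A_x-\mathbb{E}[A_x]}{\sqrt{x/\varepsilon_x}},\qquad x>0,$$ satisfies, as $x\to\infty$, the large deviation principle with speed $1/\varepsilon_x$ and good rate function $$\tilde I_1(z)=\frac{z^2}{2\Lambda''(0;\lambda,\mu)},\qquad\text{where}\qquad \Lambda''(0;\lambda,\mu)=\frac{8\lambda\mu}{(\lambda-\mu)^3}.$$ That is, $1/\varepsilon_x\to\infty$; $\tilde I_1:\mathbb{R}\to[0,\infty]$ is lower semicontinuous with compact level sets $\{\tilde I_1\le\eta\}$, $\eta\ge0$; and $$\limsup_{x\to\infty}\varepsilon_x\log P(Z_x\in F)\le-\inf_{z\in F}\tilde I_1(z)\ \text{ for all closed } F\subset\mathbb{R},$$ $$\liminf_{x\to\infty}\varepsilon_x\log P(Z_x\in G)\ge-\inf_{z\in G}\tilde I_1(z)\ \text{ for all open } G\subset\mathbb{R},$$ with the conventions $\log 0=-\infty$ and $\inf\emptyset=+\infty$. -/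

import Mathlib

open MeasureTheory ProbabilityTheory Filter Topology
open scoped ENNReal NNReal

noncomputable section

/-- The epoch of the `n`-th change of direction, when the successive changes of direction are
separated by the durations `τ 0, τ 1, τ 2, …`. -/
def telegraphEpoch (τ : ℕ → ℝ) (n : ℕ) : ℝ :=
  ∑ k ∈ Finset.range n, τ k

/-- Position at time `t ≥ 0` of the free telegraph motion on the real line with unit speed, started
at `x` and initially moving upwards: during the `k`-th period `[T_k, T_{k+1}]` the velocity is
`(-1) ^ k`, and the part of this period elapsed by time `t` has length
`min T_{k+1} t - min T_k t`. (The epochs `T_k` tend to infinity almost surely for the durations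
considered below, so that only finitely many terms are nonzero.) -/
def telegraphPosition (x : ℝ) (τ : ℕ → ℝ) (t : ℝ) : ℝ :=
  x + ∑' k : ℕ, (-1 : ℝ) ^ k *
    (min (telegraphEpoch τ (k + 1)) t - min (telegraphEpoch τ k) t)

/-- The first (strictly positive) time at which the telegraph motion started upwards at `x` is at
the origin. For `x = 0` this is the first return time to the origin. -/
def arrivalTime (x : ℝ) (τ : ℕ → ℝ) : ℝ :=
  sInf {t : ℝ | 0 < t ∧ telegraphPosition x τ t = 0}

/-- The absorption time at the origin of the particle started at `x` and absorbed at its `m`-th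
visit of the origin. The row `τ 0` holds the durations of the motion up to the first visit of the
origin, and the row `τ i`, for `i ≥ 1`, those of the motion (restarted upwards from the origin)
between the `i`-th visit and the next one. Thus it is
`C_x + 1_{m > 1} ∑_{i = 1}^{m - 1} C_{0, i}`. -/
def absorptionTime (x : ℝ) (m : ℕ) (τ : ℕ → ℕ → ℝ) : ℝ :=
  arrivalTime x (τ 0) + if 1 < m then ∑ i ∈ Finset.Icc 1 (m - 1), arrivalTime 0 (τ i) else 0

/-- `M` is a random variable with values in the positive integers whose moment generating function
is finite at some `s > 0`. -/
structure IsLightTailedCount {Ω : Type*} [MeasurableSpace Ω] (P : Measure Ω) (M : Ω → ℕ) :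
    Prop where
  measurable : Measurable M
  pos : ∀ᵐ ω ∂P, 1 ≤ M ω
  lightTailed : ∃ s : ℝ, 0 < s ∧ Integrable (fun ω => Real.exp (s * (M ω : ℝ))) P

/-- The random durations of the telegraph motion in all the cycles: they are independent, the
upward periods (even index `k`) are exponential with rate `lam`, the downward periods (odd index
`k`) are exponential with rate `mu`, and they are independent of the number `M` of visits. -/
structure IsTelegraphDurations {Ω : Type*} [MeasurableSpace Ω] (P : Measure Ω) (lam mu : ℝ)
    (M : Ω → ℕ) (τ : ℕ → ℕ → Ω → ℝ) : Prop where
  measurable : ∀ i k, Measurable (τ i k)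
  law_up : ∀ i k, Even k → P.map (τ i k) = expMeasure lam
  law_down : ∀ i k, Odd k → P.map (τ i k) = expMeasure mu
  indep : iIndepFun (fun p : ℕ × ℕ => τ p.1 p.2) P
  indep_count : IndepFun (fun ω (p : ℕ × ℕ) => τ p.1 p.2 ω) M P

/-- The absorption time as a random variable. -/
def absorptionTimeRV {Ω : Type*} (x : ℝ) (M : Ω → ℕ) (τ : ℕ → ℕ → Ω → ℝ) (ω : Ω) : ℝ :=
  absorptionTime x (M ω) (fun i k => τ i k ω)

/-- The function `Λ(s; λ, μ) = (λ - μ - √((λ + μ - 2 s)² - 4 λ μ)) / 2`. -/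
def telegraphLambda (lam mu s : ℝ) : ℝ :=
  (lam - mu - √((lam + mu - 2 * s) ^ 2 - 4 * lam * mu)) / 2

/-- The large deviation principle, as `r → ∞`, for the family `{Z r : r > 0}` of random variables
with speed function `v` and rate function `I`. Logarithms of probabilities take values in the
extended reals, with `log 0 = -∞`, and the infimum over the empty set is `+∞`. -/
structure SatisfiesLDP {Ω S : Type*} [MeasurableSpace Ω] [TopologicalSpace S] [MeasurableSpace S]
    [BorelSpace S]
    (P : Measure Ω) (Z : ℝ → Ω → S) (v : ℝ → ℝ) (I : S → ℝ≥0∞) : Prop where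
  aemeasurable : ∀ r : ℝ, 0 < r → AEMeasurable (Z r) P
  speed : Tendsto v atTop atTop
  lowerSemicontinuous : LowerSemicontinuous I
  upper_bound : ∀ F : Set S, IsClosed F →
    limsup (fun r : ℝ => ((1 / v r : ℝ) : EReal) * ENNReal.log (P (Z r ⁻¹' F))) atTop
      ≤ -(⨅ z ∈ F, (I z : EReal))
  lower_bound : ∀ G : Set S, IsOpen G →
    -(⨅ z ∈ G, (I z : EReal))
      ≤ liminf (fun r : ℝ => ((1 / v r : ℝ) : EReal) * ENNReal.log (P (Z r ⁻¹' G))) atTop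

/-- A rate function is good if its level sets (at finite levels) are compact. -/
def IsGoodRateFunction {S : Type*} [TopologicalSpace S] (I : S → ℝ≥0∞) : Prop :=
  LowerSemicontinuous I ∧ ∀ η : ℝ≥0, IsCompact {z : S | I z ≤ (η : ℝ≥0∞)}

end

/-!
The argument computes the exponential moments of the absorption time exactly and reads off the
moderate deviations from their behaviour near the origin.

*Path.* When the motion started at `x` reaches the origin, the total way down equals `x` plus the
total way up, so the arrival time is `x` plus twice the sum of the upward periods used
(`arrivalTime_eq`). The arrival takes place in the first downward period at whose end the random
walk of the local minima (`valley`) is at or below the origin (`HitsAt`).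

*Exponential moments.* If `r` solves `(λ - 2 s - r) (μ + r) = λ μ`, then
`exp (2 s * upTime + r * valley)`, multiplied by `(μ + r) / μ` before the crossing and replaced by
`exp (2 s * upTime)` at the crossing, has constant expectation, because the overshoot of the last
downward period is again exponential (`lintegral_crossing`, `aliveMoment_eq_add`). When `r` is the
smaller root, the contribution of the paths that have not yet crossed decays geometrically: it is
dominated by the corresponding moment with an exponent `r'` strictly between the two roots
(`tendsto_aliveMoment`). Hence `E[exp (s C_x)] = (μ + r) / μ * exp ((s + r) x)`
(`lintegral_exp_cycleTime`), where `s + r = Λ(s)` (`root_telegraphLambda`), and by independence of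
the cycles `E[exp (s A_x)] = exp (Λ(s) x) * E[((μ + r) / μ) ^ M]`. The last factor stays bounded
away from `0` and `∞` as `s → 0` (`exists_countMoment_bounds`).

*Large deviations.* With `s = θ / √(x ε_x)` and the expansion of `Λ` to the second order, the
scaled cumulants of `(A_x - Λ'(0) x) / √(x / ε_x)` converge to `Λ''(0) θ² / 2`
(`hasQuadraticCumulants_absorptionTimeRV`). By Jensen's inequality such a limit forces the means
to vanish asymptotically, so that centering at `E[A_x]` instead changes nothing
(`HasQuadraticCumulants.sub_integral`), and the large deviation principle follows as in the
Gärtner–Ellis theorem (`HasQuadraticCumulants.satisfiesLDP`): the upper bound from the exponential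
Markov inequality, the lower bound from the concentration of the exponentially tilted law, which is
itself seen from the exponential moments.
-/

/-! ### Paths: the arrival time as a stopped sum of upward periods -/

/-- Total duration of the first `n` upward periods. -/
def upTime (w : ℕ → ℝ) (n : ℕ) : ℝ := ∑ k ∈ Finset.range n, w (2 * k)

/-- Position after `n` upward and `n` downward periods: the local minima of the path form a random
walk started at `x`. -/
def valley (x : ℝ) (w : ℕ → ℝ) (n : ℕ) : ℝ :=
  x + ∑ k ∈ Finset.range n, (w (2 * k) - w (2 * k + 1))

/-- The origin has not been reached during the first `n` downward periods. The starting point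
itself is not tested, so that `x = 0` is covered as well. -/
def Alive (x : ℝ) (w : ℕ → ℝ) (n : ℕ) : Prop := ∀ k < n, 0 < valley x w (k + 1)

/-- The origin is reached for the first time during the downward period number `n`
(counted from `0`). -/
def HitsAt (x : ℝ) (w : ℕ → ℝ) (n : ℕ) : Prop := Alive x w n ∧ valley x w (n + 1) ≤ 0

lemma upTime_succ (w : ℕ → ℝ) (n : ℕ) : upTime w (n + 1) = upTime w n + w (2 * n) := by
  simp [upTime, Finset.sum_range_succ]

lemma valley_zero (x : ℝ) (w : ℕ → ℝ) : valley x w 0 = x := by simp [valley]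

lemma valley_succ (x : ℝ) (w : ℕ → ℝ) (n : ℕ) :
    valley x w (n + 1) = valley x w n + (w (2 * n) - w (2 * n + 1)) := by
  rw [valley, valley, Finset.sum_range_succ, add_assoc]

lemma alive_zero (x : ℝ) (w : ℕ → ℝ) : Alive x w 0 := fun k hk => absurd hk (Nat.not_lt_zero k)

lemma alive_succ (x : ℝ) (w : ℕ → ℝ) (n : ℕ) :
    Alive x w (n + 1) ↔ Alive x w n ∧ 0 < valley x w (n + 1) := by
  constructor
  · intro h
    exact ⟨fun k hk => h k (by omega), h n (by omega)⟩
  · rintro ⟨h, h'⟩ k hk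
    rcases Nat.lt_succ_iff_lt_or_eq.1 hk with hk | rfl
    · exact h k hk
    · exact h'

lemma valley_nonneg_of_alive {x : ℝ} (hx : 0 ≤ x) {w : ℕ → ℝ} {n : ℕ} (h : Alive x w n) :
    0 ≤ valley x w n := by
  cases n with
  | zero => rwa [valley_zero]
  | succ n => exact (h n (Nat.lt_succ_self n)).le

lemma HitsAt.unique {x : ℝ} {w : ℕ → ℝ} {m n : ℕ} (hm : HitsAt x w m) (hn : HitsAt x w n) :
    m = n := by
  rcases lt_trichotomy m n with h | h | h
  · exact absurd hm.2 (not_le.2 (hn.1 m h))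
  · exact h
  · exact absurd hn.2 (not_le.2 (hm.1 n h))

lemma telegraphEpoch_succ (w : ℕ → ℝ) (n : ℕ) :
    telegraphEpoch w (n + 1) = telegraphEpoch w n + w n := by
  simp [telegraphEpoch, Finset.sum_range_succ]

lemma telegraphEpoch_monotone {w : ℕ → ℝ} (hw : ∀ k, 0 < w k) : Monotone (telegraphEpoch w) :=
  monotone_nat_of_le_succ fun n => by rw [telegraphEpoch_succ]; linarith [hw n]

lemma telegraphEpoch_even (x : ℝ) (w : ℕ → ℝ) (n : ℕ) :
    telegraphEpoch w (2 * n) = 2 * upTime w n + x - valley x w n := by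
  induction n with
  | zero => simp [telegraphEpoch, upTime, valley]
  | succ n ih =>
    rw [show 2 * (n + 1) = 2 * n + 1 + 1 by ring, telegraphEpoch_succ, telegraphEpoch_succ, ih,
      upTime_succ, valley_succ]
    ring

lemma sum_alternating_even (x : ℝ) (w : ℕ → ℝ) (n : ℕ) :
    x + ∑ k ∈ Finset.range (2 * n), (-1 : ℝ) ^ k * w k = valley x w n := by
  induction n with
  | zero => simp [valley]
  | succ n ih =>
    rw [show 2 * (n + 1) = 2 * n + 1 + 1 by ring, Finset.sum_range_succ, Finset.sum_range_succ,
      valley_succ, ← ih, pow_succ, pow_mul]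
    norm_num
    ring

lemma telegraphPosition_eq {w : ℕ → ℝ} (hw : ∀ k, 0 < w k) (x : ℝ) {t : ℝ} {n : ℕ}
    (h₁ : telegraphEpoch w n ≤ t) (h₂ : t ≤ telegraphEpoch w (n + 1)) :
    telegraphPosition x w t =
      x + ∑ k ∈ Finset.range n, (-1 : ℝ) ^ k * w k + (-1) ^ n * (t - telegraphEpoch w n) := by
  have hmono := telegraphEpoch_monotone hw
  rw [telegraphPosition, tsum_eq_sum (s := Finset.range (n + 1)), Finset.sum_range_succ,
    min_eq_right h₂, min_eq_left h₁, ← add_assoc]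
  · congr 2
    refine Finset.sum_congr rfl fun k hk => ?_
    have hk : k + 1 ≤ n := Finset.mem_range.1 hk
    rw [min_eq_left ((hmono hk).trans h₁), min_eq_left ((hmono (Nat.le_of_succ_le hk)).trans h₁),
      telegraphEpoch_succ]
    ring
  · intro k hk
    have hk : n + 1 ≤ k := by simpa using hk
    rw [min_eq_right (h₂.trans (hmono hk)), min_eq_right (h₂.trans (hmono (Nat.le_succ_of_le hk)))]
    simp

lemma telegraphPosition_up {w : ℕ → ℝ} (hw : ∀ k, 0 < w k) (x : ℝ) {t : ℝ} {n : ℕ}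
    (h₁ : telegraphEpoch w (2 * n) ≤ t) (h₂ : t ≤ telegraphEpoch w (2 * n + 1)) :
    telegraphPosition x w t = valley x w n + (t - telegraphEpoch w (2 * n)) := by
  rw [telegraphPosition_eq hw x h₁ h₂, sum_alternating_even, pow_mul]
  norm_num

lemma telegraphPosition_down {w : ℕ → ℝ} (hw : ∀ k, 0 < w k) (x : ℝ) {t : ℝ} {n : ℕ}
    (h₁ : telegraphEpoch w (2 * n + 1) ≤ t) (h₂ : t ≤ telegraphEpoch w (2 * n + 2)) :
    telegraphPosition x w t = valley x w (n + 1) + (telegraphEpoch w (2 * n + 2) - t) := by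
  rw [telegraphPosition_eq hw x h₁ h₂, Finset.sum_range_succ, ← add_assoc, sum_alternating_even,
    valley_succ, telegraphEpoch_succ w (2 * n + 1), pow_succ, pow_mul]
  norm_num
  ring

/-- At the arrival at the origin the total way down is the total way up plus `x`, so that the
elapsed time is `x` plus twice the total way up. -/
theorem arrivalTime_eq {x : ℝ} (hx : 0 ≤ x) {w : ℕ → ℝ} (hw : ∀ k, 0 < w k) {n : ℕ}
    (h : HitsAt x w n) : arrivalTime x w = x + 2 * upTime w (n + 1) := by
  have hmono := telegraphEpoch_monotone hw
  have hT := telegraphEpoch_even x w (n + 1)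
  rw [show 2 * (n + 1) = 2 * n + 2 by ring] at hT
  have hT' := telegraphEpoch_succ w (2 * n + 1)
  have hv := valley_succ x w n
  have hup : 0 ≤ upTime w (n + 1) := Finset.sum_nonneg fun k _ => (hw _).le
  have hup' : 0 < upTime w (n + 1) :=
    Finset.sum_pos (fun k _ => hw _) ⟨0, by simp⟩
  have hvn := valley_nonneg_of_alive hx h.1
  refine IsLeast.csInf_eq ⟨⟨by linarith, ?_⟩, ?_⟩
  · rw [telegraphPosition_down hw x (n := n)]
    · linarith
    · have := hw (2 * n)
      linarith
    · linarith [h.2]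
  · rintro t ⟨ht0, ht⟩
    by_contra! hlt
    have hex : ∃ k, t < telegraphEpoch w k := ⟨2 * n + 2, by linarith [h.2]⟩
    classical
    obtain ⟨k, hk, hk'⟩ : ∃ k, t < telegraphEpoch w (k + 1) ∧ telegraphEpoch w k ≤ t := by
      have hs := Nat.find_spec hex
      have hm := fun m hm => Nat.find_min hex (m := m) hm
      cases hN : Nat.find hex with
      | zero => rw [hN] at hs; simp [telegraphEpoch] at hs; linarith
      | succ k => exact ⟨k, by rwa [hN] at hs, not_lt.1 (hm k (by omega))⟩
    have hkn : k < 2 * n + 2 := by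
      by_contra! hc
      have := hmono hc
      linarith [h.2]
    obtain ⟨j, rfl | rfl⟩ : ∃ j, k = 2 * j ∨ k = 2 * j + 1 := ⟨k / 2, by omega⟩
    · rw [telegraphPosition_up hw x hk' hk.le] at ht
      rcases Nat.eq_zero_or_pos j with rfl | hj
      · simp [valley, telegraphEpoch] at ht
        linarith
      · obtain ⟨i, rfl⟩ := Nat.exists_eq_succ_of_ne_zero hj.ne'
        have := h.1 i (by omega)
        simp only [Nat.succ_eq_add_one] at *
        linarith
    · rw [telegraphPosition_down hw x hk' hk.le] at ht
      rcases (show j ≤ n by omega).lt_or_eq with hj | rfl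
      · have := h.1 j hj
        have : t < telegraphEpoch w (2 * j + 2) := hk
        linarith
      · linarith

/-! ### Measurability of the stopped sum -/

lemma measurable_upTime (n : ℕ) : Measurable fun w : ℕ → ℝ => upTime w n := by
  unfold upTime; fun_prop

lemma measurable_valley (x : ℝ) (n : ℕ) : Measurable fun w : ℕ → ℝ => valley x w n := by
  unfold valley; fun_prop

lemma measurableSet_alive (x : ℝ) (n : ℕ) : MeasurableSet {w : ℕ → ℝ | Alive x w n} := by
  induction n with
  | zero => simp [alive_zero]
  | succ n ih =>
    simp only [alive_succ, Set.ofPred_and]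
    exact ih.inter (measurableSet_lt measurable_const (measurable_valley x _))

lemma measurableSet_hitsAt (x : ℝ) (n : ℕ) : MeasurableSet {w : ℕ → ℝ | HitsAt x w n} :=
  (measurableSet_alive x n).inter (measurableSet_le (measurable_valley x _) measurable_const)

open Classical in
/-- Measurable version of the arrival time: the value given by `arrivalTime_eq` on the paths which
reach the origin during one of the downward periods, and `0` on all the others. -/
noncomputable def cycleTime (x : ℝ) (w : ℕ → ℝ) : ℝ :=
  (∑' n, if HitsAt x w n then ENNReal.ofReal (x + 2 * upTime w (n + 1)) else 0).toReal

lemma measurable_cycleTime (x : ℝ) : Measurable (cycleTime x) := by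
  refine (Measurable.tsum fun n => ?_).ennreal_toReal
  exact Measurable.ite (measurableSet_hitsAt x n)
    (((measurable_upTime _).const_mul 2).const_add x).ennreal_ofReal measurable_const

lemma cycleTime_eq {x : ℝ} (hx : 0 ≤ x) {w : ℕ → ℝ} (hw : ∀ k, 0 < w k) {n : ℕ}
    (h : HitsAt x w n) : cycleTime x w = x + 2 * upTime w (n + 1) := by
  have hup : 0 ≤ upTime w (n + 1) := Finset.sum_nonneg fun k _ => (hw _).le
  rw [cycleTime, tsum_eq_single n, if_pos h, ENNReal.toReal_ofReal (by positivity)]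
  intro m hm
  rw [if_neg fun hm' => hm (hm'.unique h)]

/-! ### Exponential laws and independence -/

lemma lintegral_comp_prodMk_of_indepFun {Ω α β : Type*} [MeasurableSpace Ω] [MeasurableSpace α]
    [MeasurableSpace β] {P : Measure Ω} [IsProbabilityMeasure P] {X : Ω → α} {Y : Ω → β}
    (hX : Measurable X) (hY : Measurable Y) (h : IndepFun X Y P) {F : α → β → ℝ≥0∞}
    (hF : Measurable (Function.uncurry F)) :
    ∫⁻ ω, F (X ω) (Y ω) ∂P = ∫⁻ ω, ∫⁻ y, F (X ω) y ∂(P.map Y) ∂P := by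
  have := Measure.isProbabilityMeasure_map (μ := P) hY.aemeasurable
  have hmap := (indepFun_iff_map_prod_eq_prod_map_map hX.aemeasurable hY.aemeasurable).1 h
  calc ∫⁻ ω, F (X ω) (Y ω) ∂P
      = ∫⁻ p, Function.uncurry F p ∂(P.map fun ω => (X ω, Y ω)) :=
        (lintegral_map hF (hX.prodMk hY)).symm
    _ = ∫⁻ x, ∫⁻ y, F x y ∂(P.map Y) ∂(P.map X) := by
        rw [hmap, lintegral_prod _ hF.aemeasurable]; rfl
    _ = ∫⁻ ω, ∫⁻ y, F (X ω) y ∂(P.map Y) ∂P :=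
        lintegral_map hF.lintegral_prod_right' hX

lemma expMeasure_eq_withDensity (r : ℝ) :
    expMeasure r = volume.withDensity (exponentialPDF r) := rfl

lemma measurable_exponentialPDF (r : ℝ) : Measurable (exponentialPDF r) :=
  (measurable_exponentialPDFReal r).ennreal_ofReal

/-- Exponential tilting changes the rate of an exponential law. -/
lemma setLIntegral_exp_expMeasure {r c : ℝ} (hr : 0 < r) (hc : c < r) {s : Set ℝ}
    (hs : MeasurableSet s) :
    ∫⁻ x in s, ENNReal.ofReal (Real.exp (c * x)) ∂(expMeasure r) =
      ENNReal.ofReal (r / (r - c)) * expMeasure (r - c) s := by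
  have hrc : 0 < r - c := sub_pos.2 hc
  rw [expMeasure_eq_withDensity, expMeasure_eq_withDensity, withDensity_apply _ hs,
    setLIntegral_withDensity_eq_setLIntegral_mul _ (measurable_exponentialPDF r)
      (by fun_prop) hs, ← lintegral_const_mul _ (measurable_exponentialPDF _)]
  refine lintegral_congr fun x => ?_
  simp only [Pi.mul_apply, exponentialPDF_eq]
  rw [← ENNReal.ofReal_mul (by split_ifs <;> positivity), ← ENNReal.ofReal_mul (by positivity)]
  congr 1
  split_ifs
  · rw [mul_assoc, ← Real.exp_add, ← mul_assoc, div_mul_cancel₀ _ hrc.ne']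
    congr 2; ring
  · simp

lemma lintegral_exp_expMeasure {r c : ℝ} (hr : 0 < r) (hc : c < r) :
    ∫⁻ x, ENNReal.ofReal (Real.exp (c * x)) ∂(expMeasure r) = ENNReal.ofReal (r / (r - c)) := by
  have := isProbabilityMeasure_expMeasure (sub_pos.2 hc)
  rw [← setLIntegral_univ, setLIntegral_exp_expMeasure hr hc MeasurableSet.univ, measure_univ,
    mul_one]

lemma expMeasure_Iic {r : ℝ} (hr : 0 < r) {z : ℝ} (hz : 0 ≤ z) :
    expMeasure r (Set.Iic z) = ENNReal.ofReal (1 - Real.exp (-(r * z))) := by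
  rw [expMeasure_eq_withDensity, withDensity_apply _ measurableSet_Iic,
    lintegral_exponentialPDF_eq_antiDeriv hr, if_pos hz]

lemma expMeasure_Iio {r : ℝ} (hr : 0 < r) {z : ℝ} (hz : 0 ≤ z) :
    expMeasure r (Set.Iio z) = ENNReal.ofReal (1 - Real.exp (-(r * z))) := by
  rw [← expMeasure_Iic hr hz]
  refine measure_congr (withDensity_absolutelyContinuous volume (exponentialPDF r) ?_)
  exact Iio_ae_eq_Iic

lemma expMeasure_Ici {r : ℝ} (hr : 0 < r) {z : ℝ} (hz : 0 ≤ z) :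
    expMeasure r (Set.Ici z) = ENNReal.ofReal (Real.exp (-(r * z))) := by
  have := isProbabilityMeasure_expMeasure hr
  rw [← Set.compl_Iio, prob_compl_eq_one_sub measurableSet_Iio, expMeasure_Iio hr hz,
    ← ENNReal.ofReal_one, ← ENNReal.ofReal_sub _ (by simpa using mul_nonneg hr.le hz)]
  simp

lemma ae_pos_expMeasure {r : ℝ} (hr : 0 < r) : ∀ᵐ x ∂(expMeasure r), 0 < x := by
  have : {x : ℝ | ¬ 0 < x} = Set.Iic 0 := by ext; simp
  rw [ae_iff, this, expMeasure_Iic hr le_rfl]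
  simp

/-! ### The moment generating function of a cycle -/

/-- Rate of the `k`-th period. -/
noncomputable def periodRate (lam mu : ℝ) (k : ℕ) : ℝ := if Even k then lam else mu

/-- Joint law of the successive periods of one cycle. -/
noncomputable def periodLaw (lam mu : ℝ) : Measure (ℕ → ℝ) :=
  Measure.infinitePi fun k => expMeasure (periodRate lam mu k)

section Cycle

variable {lam mu : ℝ}

lemma periodRate_pos (hlam : 0 < lam) (hmu : 0 < mu) (k : ℕ) : 0 < periodRate lam mu k := by
  unfold periodRate; split_ifs <;> assumption

lemma periodRate_even (n : ℕ) : periodRate lam mu (2 * n) = lam := by simp [periodRate]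

lemma periodRate_odd (n : ℕ) : periodRate lam mu (2 * n + 1) = mu := by simp [periodRate]

lemma isProbabilityMeasure_periodLaw (hlam : 0 < lam) (hmu : 0 < mu) :
    IsProbabilityMeasure (periodLaw lam mu) := by
  have := fun k => isProbabilityMeasure_expMeasure (periodRate_pos hlam hmu k)
  unfold periodLaw; infer_instance

lemma periodLaw_map_eval (hlam : 0 < lam) (hmu : 0 < mu) (k : ℕ) :
    (periodLaw lam mu).map (fun w => w k) = expMeasure (periodRate lam mu k) := by
  have := fun k => isProbabilityMeasure_expMeasure (periodRate_pos hlam hmu k)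
  exact Measure.infinitePi_map_eval _ k

lemma ae_pos_periodLaw (hlam : 0 < lam) (hmu : 0 < mu) :
    ∀ᵐ w ∂(periodLaw lam mu), ∀ k, 0 < w k := by
  refine ae_all_iff.2 fun k => ?_
  have h := ae_pos_expMeasure (periodRate_pos hlam hmu k)
  rw [← periodLaw_map_eval hlam hmu k] at h
  exact ae_of_ae_map (measurable_pi_apply k).aemeasurable h

/-- The `n`-th period can be integrated out when the rest of the integrand depends on the previous
periods only. -/
lemma lintegral_periodLaw_coord (hlam : 0 < lam) (hmu : 0 < mu) (n : ℕ) {F : (ℕ → ℝ) → ℝ → ℝ≥0∞}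
    (hF : Measurable (Function.uncurry F))
    (hdep : ∀ w w' : ℕ → ℝ, (∀ k < n, w k = w' k) → F w = F w') :
    ∫⁻ w, F w (w n) ∂(periodLaw lam mu) =
      ∫⁻ w, ∫⁻ u, F w u ∂(expMeasure (periodRate lam mu n)) ∂(periodLaw lam mu) := by
  classical
  have := fun k => isProbabilityMeasure_expMeasure (periodRate_pos hlam hmu k)
  have := isProbabilityMeasure_periodLaw hlam hmu
  have hind : iIndepFun (fun (k : ℕ) (w : ℕ → ℝ) => w k) (periodLaw lam mu) :=
    iIndepFun_infinitePi (X := fun _ x => x) fun _ => measurable_id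
  have h := hind.indepFun_finset (Finset.range n) {n} (by simp) fun k => measurable_pi_apply k
  have h' := h.comp (φ := id) (ψ := fun v : ({n} : Finset ℕ) → ℝ => v ⟨n, by simp⟩)
    measurable_id (measurable_pi_apply (X := fun _ : ({n} : Finset ℕ) => ℝ) ⟨n, by simp⟩)
  -- sequences that agree with `v` on the previous periods and vanish afterwards
  let ext : (Finset.range n → ℝ) → ℕ → ℝ := fun v k =>
    if hk : k ∈ Finset.range n then v ⟨k, hk⟩ else 0
  have hext : Measurable ext := by
    refine measurable_pi_lambda _ fun k => ?_
    by_cases hk : k ∈ Finset.range n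
    · simp only [ext, dif_pos hk]
      exact measurable_pi_apply (X := fun _ : Finset.range n => ℝ) ⟨k, hk⟩
    · simp only [ext, dif_neg hk]
      exact measurable_const
  have key := lintegral_comp_prodMk_of_indepFun (P := periodLaw lam mu)
    (X := fun w (k : Finset.range n) => w k) (Y := fun w => w n) (by fun_prop) (by fun_prop) h'
    (F := fun v u => F (ext v) u)
    (hF.comp ((hext.comp measurable_fst).prodMk measurable_snd))
  rw [periodLaw_map_eval hlam hmu] at key
  have hFe : ∀ w : ℕ → ℝ, F (ext fun k => w k) = F w := fun w =>
    hdep _ _ fun k hk => by simp [ext, hk]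
  simpa only [hFe] using key

lemma upTime_congr {w w' : ℕ → ℝ} {n : ℕ} (h : ∀ k < 2 * n, w k = w' k) :
    upTime w n = upTime w' n :=
  Finset.sum_congr rfl fun k hk => h _ (by have := Finset.mem_range.1 hk; omega)

lemma valley_congr (x : ℝ) {w w' : ℕ → ℝ} {n : ℕ} (h : ∀ k < 2 * n, w k = w' k) :
    valley x w n = valley x w' n := by
  unfold valley
  congr 1
  refine Finset.sum_congr rfl fun k hk => ?_
  have := Finset.mem_range.1 hk
  rw [h _ (by omega), h _ (by omega)]

lemma alive_congr (x : ℝ) {w w' : ℕ → ℝ} {n : ℕ} (h : ∀ k < 2 * n, w k = w' k) :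
    Alive x w n ↔ Alive x w' n := by
  refine forall₂_congr fun k hk => ?_
  rw [valley_congr x fun j hj => h j (by omega)]

/-- Without stopping, one up-and-down period multiplies the exponential moment by a constant. -/
lemma lintegral_exp_valley (hlam : 0 < lam) (hmu : 0 < mu) {s r : ℝ} (h₁ : 2 * s + r < lam)
    (h₂ : 0 < mu + r) (x : ℝ) (n : ℕ) :
    ∫⁻ w, ENNReal.ofReal (Real.exp (2 * s * upTime w n + r * valley x w n)) ∂(periodLaw lam mu) =
      ENNReal.ofReal (lam / (lam - (2 * s + r)) * (mu / (mu + r))) ^ n *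
        ENNReal.ofReal (Real.exp (r * x)) := by
  have := isProbabilityMeasure_periodLaw hlam hmu
  have hE : ∀ a b : ℝ, ENNReal.ofReal (Real.exp (a + b)) =
      ENNReal.ofReal (Real.exp a) * ENNReal.ofReal (Real.exp b) := fun a b => by
    rw [Real.exp_add, ENNReal.ofReal_mul (Real.exp_nonneg a)]
  induction n with
  | zero => simp [upTime, valley]
  | succ n ih =>
    have m₁ := measurable_upTime n
    have m₂ := measurable_valley x n
    have e : ∀ w : ℕ → ℝ, ENNReal.ofReal
        (Real.exp (2 * s * upTime w (n + 1) + r * valley x w (n + 1))) =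
        ENNReal.ofReal (Real.exp (2 * s * upTime w n + r * valley x w n)) *
          ENNReal.ofReal (Real.exp ((2 * s + r) * w (2 * n))) *
          ENNReal.ofReal (Real.exp (-r * w (2 * n + 1))) := fun w => by
      rw [← hE, ← hE, upTime_succ, valley_succ]; congr 2; ring
    simp_rw [e]
    rw [lintegral_periodLaw_coord hlam hmu (2 * n + 1) (F := fun w u =>
        ENNReal.ofReal (Real.exp (2 * s * upTime w n + r * valley x w n)) *
          ENNReal.ofReal (Real.exp ((2 * s + r) * w (2 * n))) *
          ENNReal.ofReal (Real.exp (-r * u))) (by unfold Function.uncurry; fun_prop)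
        fun w w' h => by
          ext u
          rw [upTime_congr fun k hk => h k (by omega), valley_congr x fun k hk => h k (by omega),
            h _ (by omega)]]
    rw [periodRate_odd]
    simp_rw [lintegral_const_mul' _ _ (ENNReal.mul_ne_top ENNReal.ofReal_ne_top
      ENNReal.ofReal_ne_top), lintegral_exp_expMeasure hmu (show -r < mu by linarith)]
    rw [lintegral_mul_const' _ _ ENNReal.ofReal_ne_top,
      lintegral_periodLaw_coord hlam hmu (2 * n) (F := fun w u =>
        ENNReal.ofReal (Real.exp (2 * s * upTime w n + r * valley x w n)) *
          ENNReal.ofReal (Real.exp ((2 * s + r) * u))) (by unfold Function.uncurry; fun_prop)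
        fun w w' h => by
          ext u
          rw [upTime_congr fun k hk => h k (by omega), valley_congr x fun k hk => h k (by omega)],
      periodRate_even]
    simp_rw [lintegral_const_mul' _ _ ENNReal.ofReal_ne_top, lintegral_exp_expMeasure hlam h₁]
    rw [lintegral_mul_const' _ _ ENNReal.ofReal_ne_top, ih, sub_neg_eq_add,
      ENNReal.ofReal_mul (div_nonneg hlam.le (by linarith))]
    ring

/-- The crossing of the origin during a downward period started at height `z`: by the lack of
memory of the overshoot the value `1` at the crossing and the value `(mu + r) / mu * exp (r y)` at
a positive valley `y` average to `exp (r z)`. -/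
lemma lintegral_crossing (hmu : 0 < mu) {r : ℝ} (h₂ : 0 < mu + r) {z : ℝ} (hz : 0 ≤ z) :
    ∫⁻ d, (if z - d ≤ 0 then 1 else ENNReal.ofReal ((mu + r) / mu * Real.exp (r * (z - d))))
      ∂(expMeasure mu) = ENNReal.ofReal (Real.exp (r * z)) := by
  have hs : {d : ℝ | z - d ≤ 0} = Set.Ici z := by ext; simp
  have hfun : (fun d => if z - d ≤ 0 then (1 : ℝ≥0∞) else
      ENNReal.ofReal ((mu + r) / mu * Real.exp (r * (z - d)))) =
      (Set.Ici z).piecewise (fun _ => 1) fun d =>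
        ENNReal.ofReal ((mu + r) / mu * Real.exp (r * z)) * ENNReal.ofReal (Real.exp (-r * d)) := by
    ext d
    by_cases h : z - d ≤ 0
    · rw [if_pos h, Set.piecewise_eq_of_mem _ _ _ (show d ∈ Set.Ici z by simpa using h)]
    · rw [if_neg h, Set.piecewise_eq_of_notMem _ _ _ (show d ∉ Set.Ici z by simpa using h),
        ← ENNReal.ofReal_mul (by positivity), mul_assoc, ← Real.exp_add]
      congr 3; ring
  have h₃ := mul_nonneg h₂.le hz
  rw [hfun, lintegral_piecewise measurableSet_Ici, setLIntegral_const, one_mul,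
    expMeasure_Ici hmu hz, Set.compl_Ici, lintegral_const_mul' _ _ ENNReal.ofReal_ne_top,
    setLIntegral_exp_expMeasure hmu (by linarith) measurableSet_Iio, sub_neg_eq_add,
    expMeasure_Iio h₂ hz, ← ENNReal.ofReal_mul (by positivity), ← ENNReal.ofReal_mul (by positivity),
    ← ENNReal.ofReal_add (Real.exp_nonneg _)]
  · congr 1
    have : Real.exp (r * z) * Real.exp (-((mu + r) * z)) = Real.exp (-(mu * z)) := by
      rw [← Real.exp_add]; congr 1; ring
    rw [← this]
    field_simp
    ring
  · refine mul_nonneg (by positivity) (mul_nonneg (by positivity) ?_)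
    simpa using h₃

/-- Exponential moment carried by the paths that have not reached the origin during the first `n`
up-and-down periods, weighted as in the stopped exponential martingale: at a valley `y` before the
crossing the expected future contribution is `(mu + r) / mu * exp (r y)`. -/
noncomputable def aliveMoment (lam mu s r x : ℝ) (n : ℕ) : ℝ≥0∞ :=
  ∫⁻ w, {w | Alive x w n}.indicator (fun w => ENNReal.ofReal
    ((mu + r) / mu * Real.exp (2 * s * upTime w n + r * valley x w n))) w ∂(periodLaw lam mu)

/-- Exponential moment of the upward time at the crossing of the origin during period `n`. -/
noncomputable def hitMoment (lam mu s x : ℝ) (n : ℕ) : ℝ≥0∞ :=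
  ∫⁻ w, {w | HitsAt x w n}.indicator (fun w => ENNReal.ofReal
    (Real.exp (2 * s * upTime w (n + 1)))) w ∂(periodLaw lam mu)

/-- One step of the exponential martingale stopped at the crossing of the origin. -/
lemma aliveMoment_eq_add (hlam : 0 < lam) (hmu : 0 < mu) {s r : ℝ} (h₁ : 2 * s + r < lam)
    (h₂ : 0 < mu + r) (hroot : (lam - (2 * s + r)) * (mu + r) = lam * mu) {x : ℝ} (hx : 0 ≤ x)
    (n : ℕ) :
    aliveMoment lam mu s r x n = hitMoment lam mu s x n + aliveMoment lam mu s r x (n + 1) := by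
  have := isProbabilityMeasure_periodLaw hlam hmu
  have hE : ∀ a b : ℝ, ENNReal.ofReal (Real.exp (a + b)) =
      ENNReal.ofReal (Real.exp a) * ENNReal.ofReal (Real.exp b) := fun a b => by
    rw [Real.exp_add, ENNReal.ofReal_mul (Real.exp_nonneg a)]
  have m₁ := measurable_upTime n
  have m₂ := measurable_valley x n
  have mA := measurableSet_alive x n
  have m₁' := measurable_upTime (n + 1)
  have m₂' := measurable_valley x (n + 1)
  -- weight of the past
  let W : (ℕ → ℝ) → ℝ≥0∞ := {w | Alive x w n}.indicator fun w =>
    ENNReal.ofReal (Real.exp (2 * s * upTime w n))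
  have hW : Measurable W := Measurable.indicator (by fun_prop) mA
  have hWtop : ∀ w, W w ≠ ∞ := fun w => by
    by_cases h : Alive x w n <;> simp [W, h]
  have hWc : ∀ w w' : ℕ → ℝ, (∀ k < 2 * n, w k = w' k) → W w = W w' := fun w w' h => by
    by_cases hA : Alive x w n
    · have hA' := (alive_congr x h).1 hA
      simp [W, hA, hA', upTime_congr h]
    · have hA' : ¬ Alive x w' n := fun h' => hA ((alive_congr x h).2 h')
      simp only [W, Set.indicator, Set.mem_ofPred_eq, hA, hA', if_false]
  let H : ℝ → ℝ → ℝ≥0∞ := fun z d =>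
    if z - d ≤ 0 then 1 else ENNReal.ofReal ((mu + r) / mu * Real.exp (r * (z - d)))
  have hH : Measurable (Function.uncurry H) :=
    Measurable.ite (measurableSet_le (by fun_prop) measurable_const) measurable_const
      (by fun_prop)
  have step₁ : hitMoment lam mu s x n + aliveMoment lam mu s r x (n + 1) =
      ∫⁻ w, W w * ENNReal.ofReal (Real.exp (2 * s * w (2 * n))) *
        H (valley x w n + w (2 * n)) (w (2 * n + 1)) ∂(periodLaw lam mu) := by
    rw [hitMoment, aliveMoment, ← lintegral_add_left
      (Measurable.indicator (by fun_prop) (measurableSet_hitsAt x n))]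
    refine lintegral_congr fun w => ?_
    have hv : valley x w (n + 1) = valley x w n + w (2 * n) - w (2 * n + 1) := by
      rw [valley_succ]; ring
    by_cases hA : Alive x w n
    · by_cases hz : valley x w (n + 1) ≤ 0
      · have h1 : HitsAt x w n := ⟨hA, hz⟩
        have h2 : ¬ Alive x w (n + 1) := fun h => absurd hz (not_le.2 ((alive_succ x w n).1 h).2)
        simp only [Set.indicator, Set.mem_ofPred_eq, h1, h2, if_true, if_false, W, H, hA, ← hv, hz,
          ← hE, add_zero, mul_one]
        rw [upTime_succ]; congr 2; ring
      · have h1 : ¬ HitsAt x w n := fun h => hz h.2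
        have h2 : Alive x w (n + 1) := (alive_succ x w n).2 ⟨hA, not_le.1 hz⟩
        simp only [Set.indicator, Set.mem_ofPred_eq, h1, h2, if_true, if_false, W, H, hA, ← hv, hz,
          ← hE, zero_add]
        rw [← ENNReal.ofReal_mul (by positivity), mul_left_comm, ← Real.exp_add, upTime_succ]
        congr 3; ring
    · have h1 : ¬ HitsAt x w n := fun h => hA h.1
      have h2 : ¬ Alive x w (n + 1) := fun h => hA ((alive_succ x w n).1 h).1
      simp [Set.indicator, h1, h2, W, hA]
  rw [step₁, lintegral_periodLaw_coord hlam hmu (2 * n + 1) (F := fun w d =>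
      W w * ENNReal.ofReal (Real.exp (2 * s * w (2 * n))) * H (valley x w n + w (2 * n)) d)
    ((by fun_prop : Measurable fun p : (ℕ → ℝ) × ℝ =>
      W p.1 * ENNReal.ofReal (Real.exp (2 * s * p.1 (2 * n)))).mul
      (hH.comp (by fun_prop : Measurable fun p : (ℕ → ℝ) × ℝ =>
        (valley x p.1 n + p.1 (2 * n), p.2))))
    fun w w' h => by
      ext u
      rw [hWc w w' fun k hk => h k (by omega), valley_congr x fun k hk => h k (by omega),
        h _ (by omega)],
    periodRate_odd]
  have step₂ : ∫⁻ w, ∫⁻ d, W w * ENNReal.ofReal (Real.exp (2 * s * w (2 * n))) *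
        H (valley x w n + w (2 * n)) d ∂(expMeasure mu) ∂(periodLaw lam mu) =
      ∫⁻ w, W w * ENNReal.ofReal (Real.exp (r * valley x w n)) *
        ENNReal.ofReal (Real.exp ((2 * s + r) * w (2 * n))) ∂(periodLaw lam mu) := by
    refine lintegral_congr_ae ?_
    filter_upwards [ae_pos_periodLaw hlam hmu] with w hw
    rw [lintegral_const_mul' _ _ (ENNReal.mul_ne_top (hWtop w) ENNReal.ofReal_ne_top)]
    by_cases hA : Alive x w n
    · have hz : 0 ≤ valley x w n + w (2 * n) :=
        add_nonneg (valley_nonneg_of_alive hx hA) (hw _).le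
      rw [show ∫⁻ d, H (valley x w n + w (2 * n)) d ∂(expMeasure mu) = _ from
        lintegral_crossing hmu h₂ hz, mul_assoc (W w), mul_assoc (W w), ← hE, ← hE]
      congr 3; ring
    · simp [W, hA]
  rw [step₂, lintegral_periodLaw_coord hlam hmu (2 * n) (F := fun w u =>
      W w * ENNReal.ofReal (Real.exp (r * valley x w n)) *
        ENNReal.ofReal (Real.exp ((2 * s + r) * u))) (by unfold Function.uncurry; fun_prop)
    fun w w' h => by ext u; rw [hWc w w' h, valley_congr x h], periodRate_even]
  refine lintegral_congr fun w => ?_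
  rw [lintegral_const_mul' _ _ (ENNReal.mul_ne_top (hWtop w) ENNReal.ofReal_ne_top),
    lintegral_exp_expMeasure hlam h₁]
  have hq : lam / (lam - (2 * s + r)) = (mu + r) / mu := by
    rw [div_eq_div_iff (by linarith) hmu.ne']; linarith
  by_cases hA : Alive x w n
  · simp only [Set.indicator, Set.mem_ofPred_eq, hA, if_true, W, ← hE, hq]
    rw [mul_comm, ENNReal.ofReal_mul (by positivity)]
  · simp [W, hA]

lemma tendsto_aliveMoment (hlam : 0 < lam) (hmu : 0 < mu) {s r r' : ℝ}
    (h₂ : 0 < mu + r) (hrr' : r ≤ r') (h₁' : 2 * s + r' < lam)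
    (hr' : lam * mu < (lam - (2 * s + r')) * (mu + r')) {x : ℝ} (hx : 0 ≤ x) :
    Tendsto (aliveMoment lam mu s r x) atTop (𝓝 0) := by
  set ρ : ℝ := lam / (lam - (2 * s + r')) * (mu / (mu + r')) with hρ
  have h₂' : 0 < mu + r' := by linarith
  have hρ1 : ρ < 1 := by
    rw [hρ, div_mul_div_comm, div_lt_one (mul_pos (by linarith) h₂')]; exact hr'
  have hbound : ∀ n, aliveMoment lam mu s r x n ≤
      ENNReal.ofReal ((mu + r) / mu) * (ENNReal.ofReal ρ ^ n *
        ENNReal.ofReal (Real.exp (r' * x))) := fun n => by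
    rw [hρ, ← lintegral_exp_valley hlam hmu h₁' h₂' x n,
      ← lintegral_const_mul' _ _ ENNReal.ofReal_ne_top]
    refine lintegral_mono fun w => ?_
    by_cases hA : Alive x w n
    swap
    · simp [Set.indicator, hA]
    rw [Set.indicator_of_mem (s := {w | Alive x w n}) hA, ← ENNReal.ofReal_mul (by positivity)]
    have := mul_le_mul_of_nonneg_right hrr' (valley_nonneg_of_alive hx hA)
    gcongr
  refine tendsto_of_tendsto_of_tendsto_of_le_of_le tendsto_const_nhds ?_ (fun _ => zero_le)
    hbound
  have h := ENNReal.Tendsto.mul_const (b := ENNReal.ofReal (Real.exp (r' * x)))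
    (ENNReal.tendsto_pow_atTop_nhds_zero_of_lt_one (r := ENNReal.ofReal ρ) (by simpa using hρ1))
    (Or.inr ENNReal.ofReal_ne_top)
  simpa using ENNReal.Tendsto.const_mul (a := ENNReal.ofReal ((mu + r) / mu)) h
    (Or.inr ENNReal.ofReal_ne_top)

/-- Optional stopping for the exponential martingale: the hypothesis on `r'` makes the contribution
of the paths that stay alive vanish. -/
lemma tsum_hitMoment (hlam : 0 < lam) (hmu : 0 < mu) {s r r' : ℝ}
    (h₂ : 0 < mu + r) (hroot : (lam - (2 * s + r)) * (mu + r) = lam * mu) (hrr' : r ≤ r')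
    (h₁' : 2 * s + r' < lam) (hr' : lam * mu < (lam - (2 * s + r')) * (mu + r')) {x : ℝ}
    (hx : 0 ≤ x) :
    ∑' n, hitMoment lam mu s x n = ENNReal.ofReal ((mu + r) / mu * Real.exp (r * x)) := by
  have := isProbabilityMeasure_periodLaw hlam hmu
  have hsum : ∀ n, ∑ k ∈ Finset.range n, hitMoment lam mu s x k + aliveMoment lam mu s r x n =
      ENNReal.ofReal ((mu + r) / mu * Real.exp (r * x)) := fun n => by
    induction n with
    | zero => simp [aliveMoment, alive_zero, upTime, valley]
    | succ n ih =>
      rw [Finset.sum_range_succ, add_assoc,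
        ← aliveMoment_eq_add hlam hmu (by linarith) h₂ hroot hx n, ih]
  have h := (ENNReal.tendsto_nat_tsum fun k => hitMoment lam mu s x k).add
    (tendsto_aliveMoment hlam hmu h₂ hrr' h₁' hr' hx)
  simp only [hsum, add_zero] at h
  exact tendsto_nhds_unique h tendsto_const_nhds

/-- The origin is reached almost surely. -/
lemma ae_exists_hitsAt (hmu : 0 < mu) (hlam : mu < lam) {x : ℝ} (hx : 0 ≤ x) :
    ∀ᵐ w ∂(periodLaw lam mu), ∃ n, HitsAt x w n := by
  have hlam0 := hmu.trans hlam
  have := isProbabilityMeasure_periodLaw hlam0 hmu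
  -- for `s = 0` the smaller root is `r = 0`
  have h := tsum_hitMoment hlam0 hmu (s := 0) (r := 0) (r' := (lam - mu) / 2) (by linarith)
    (by ring) (by linarith) (by linarith) (by nlinarith) hx
  have hset : {w | ∃ n, HitsAt x w n} = ⋃ n, {w | HitsAt x w n} := by ext; simp
  have hm : MeasurableSet {w : ℕ → ℝ | ∃ n, HitsAt x w n} := by
    rw [hset]; exact MeasurableSet.iUnion fun n => measurableSet_hitsAt x n
  refine (mem_ae_iff_prob_eq_one hm).2 ?_
  have hdisj : Pairwise (Function.onFun Disjoint fun n => {w : ℕ → ℝ | HitsAt x w n}) :=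
    fun m n hmn => Set.disjoint_left.2 fun w hw hw' => hmn (HitsAt.unique hw hw')
  rw [hset, measure_iUnion hdisj fun n => measurableSet_hitsAt x n]
  have h1 : ENNReal.ofReal ((mu + 0) / mu * Real.exp (0 * x)) = 1 := by simp [hmu.ne']
  rw [← h1, ← h]
  refine tsum_congr fun n => ?_
  simp [hitMoment, lintegral_indicator (measurableSet_hitsAt x n)]

/-- Exact exponential moments of the first arrival at the origin, `r` being the smaller root of
`(lam - 2 s - r) (mu + r) = lam mu`. -/
theorem lintegral_exp_cycleTime (hmu : 0 < mu) (hlam : mu < lam) {s r r' : ℝ}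
    (h₂ : 0 < mu + r) (hroot : (lam - (2 * s + r)) * (mu + r) = lam * mu) (hrr' : r ≤ r')
    (h₁' : 2 * s + r' < lam) (hr' : lam * mu < (lam - (2 * s + r')) * (mu + r')) {x : ℝ}
    (hx : 0 ≤ x) :
    ∫⁻ w, ENNReal.ofReal (Real.exp (s * cycleTime x w)) ∂(periodLaw lam mu) =
      ENNReal.ofReal ((mu + r) / mu * Real.exp ((s + r) * x)) := by
  have hlam0 := hmu.trans hlam
  have hae : ∀ᵐ w ∂(periodLaw lam mu), ENNReal.ofReal (Real.exp (s * cycleTime x w)) =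
      ENNReal.ofReal (Real.exp (s * x)) * ∑' n, {w | HitsAt x w n}.indicator (fun w =>
        ENNReal.ofReal (Real.exp (2 * s * upTime w (n + 1)))) w := by
    filter_upwards [ae_pos_periodLaw hlam0 hmu, ae_exists_hitsAt hmu hlam hx] with w hw hh
    obtain ⟨n, hn⟩ := hh
    rw [cycleTime_eq hx hw hn, tsum_eq_single n fun m hm =>
      Set.indicator_of_notMem (s := {w | HitsAt x w m}) (fun h => hm (HitsAt.unique h hn)) _,
      Set.indicator_of_mem (s := {w | HitsAt x w n}) hn, ← ENNReal.ofReal_mul (Real.exp_nonneg _),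
      ← Real.exp_add]
    congr 2; ring
  rw [lintegral_congr_ae hae, lintegral_const_mul' _ _ ENNReal.ofReal_ne_top, lintegral_tsum]
  · rw [show ∑' n, ∫⁻ w, {w | HitsAt x w n}.indicator (fun w =>
        ENNReal.ofReal (Real.exp (2 * s * upTime w (n + 1)))) w ∂(periodLaw lam mu) =
        ∑' n, hitMoment lam mu s x n from rfl,
      tsum_hitMoment hlam0 hmu h₂ hroot hrr' h₁' hr' hx,
      ← ENNReal.ofReal_mul (Real.exp_nonneg _), mul_left_comm, ← Real.exp_add, add_mul]
  · intro n
    have := measurable_upTime (n + 1)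
    exact (Measurable.indicator (by fun_prop) (measurableSet_hitsAt x n)).aemeasurable

end Cycle

/-! ### The absorption time -/

/-- If all the entries of an array are independent, then so are its rows. -/
lemma iIndepFun_rows {Ω ι κ E : Type*} [MeasurableSpace Ω] [MeasurableSpace E] {P : Measure Ω}
    {X : ι → κ → Ω → E} (hX : ∀ i k, Measurable (X i k))
    (h : iIndepFun (fun p : ι × κ => X p.1 p.2) P) : iIndepFun (fun i ω k => X i k ω) P := by
  have := h.isProbabilityMeasure
  have hprob : ∀ i k, IsProbabilityMeasure (P.map (X i k)) :=
    fun i k => Measure.isProbabilityMeasure_map (hX i k).aemeasurable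
  have hmap := (iIndepFun_iff_map_fun_eq_infinitePi_map fun p => hX _ _).1 h
  have hrow : ∀ i, iIndepFun (X i) P := fun i =>
    h.precomp (g := fun k => (i, k)) fun k k' hk => by simpa using hk
  rw [iIndepFun_iff_map_fun_eq_infinitePi_map fun i => measurable_pi_lambda _ fun k => hX i k]
  have hcurry : (fun ω i k => X i k ω) =
      MeasurableEquiv.curry ι κ E ∘ fun ω (p : ι × κ) => X p.1 p.2 ω := rfl
  rw [hcurry, ← Measure.map_map (by fun_prop) (measurable_pi_lambda _ fun p => hX _ _), hmap,
    Measure.infinitePi_map_curry fun i k => P.map (X i k)]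
  congr 1
  ext1 i
  rw [(iIndepFun_iff_map_fun_eq_infinitePi_map fun k => hX i k).1 (hrow i)]

section Absorption

variable {Ω : Type*} [MeasurableSpace Ω] {P : Measure Ω} {lam mu : ℝ}
  {M : Ω → ℕ} {τ : ℕ → ℕ → Ω → ℝ}

lemma IsTelegraphDurations.measurable_row (h : IsTelegraphDurations P lam mu M τ) (i : ℕ) :
    Measurable fun ω k => τ i k ω :=
  measurable_pi_lambda _ fun k => h.measurable i k

lemma IsTelegraphDurations.map_row [IsProbabilityMeasure P]
    (h : IsTelegraphDurations P lam mu M τ) (i : ℕ) :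
    P.map (fun ω k => τ i k ω) = periodLaw lam mu := by
  have hrow : iIndepFun (τ i) P :=
    h.indep.precomp (g := fun k => (i, k)) fun k k' hk => by simpa using hk
  rw [(iIndepFun_iff_map_fun_eq_infinitePi_map fun k => h.measurable i k).1 hrow, periodLaw]
  congr 1
  ext1 k
  rcases Nat.even_or_odd k with hk | hk
  · rw [h.law_up i k hk, periodRate, if_pos hk]
  · rw [h.law_down i k hk, periodRate, if_neg (Nat.not_even_iff_odd.2 hk)]

/-- Measurable version of the absorption time, as a function of all the periods. -/
noncomputable def totalTime (x : ℝ) (m : ℕ) (t : ℕ → ℕ → ℝ) : ℝ :=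
  cycleTime x (t 0) + ∑ i ∈ Finset.range (m - 1), cycleTime 0 (t (i + 1))

lemma measurable_totalTime (x : ℝ) (m : ℕ) : Measurable (totalTime x m) := by
  have h₀ := measurable_cycleTime 0
  have h := measurable_cycleTime x
  unfold totalTime
  fun_prop

lemma measurable_totalTime_uncurry (x : ℝ) :
    Measurable fun p : ℕ × (ℕ → ℕ → ℝ) => totalTime x p.1 p.2 :=
  measurable_from_prod_countable_right fun m => measurable_totalTime x m

lemma IsTelegraphDurations.measurable_array (h : IsTelegraphDurations P lam mu M τ) :
    Measurable fun ω i k => τ i k ω :=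
  measurable_pi_lambda _ fun i => h.measurable_row i

lemma absorptionTimeRV_ae_eq [IsProbabilityMeasure P] (hmu : 0 < mu) (hlam : mu < lam)
    (h : IsTelegraphDurations P lam mu M τ) {x : ℝ} (hx : 0 ≤ x) :
    absorptionTimeRV x M τ =ᵐ[P] fun ω => totalTime x (M ω) fun i k => τ i k ω := by
  have key : ∀ y : ℝ, 0 ≤ y → ∀ᵐ w ∂(periodLaw lam mu), arrivalTime y w = cycleTime y w := by
    intro y hy
    filter_upwards [ae_pos_periodLaw (hmu.trans hlam) hmu, ae_exists_hitsAt hmu hlam hy]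
      with w hw hh
    obtain ⟨n, hn⟩ := hh
    rw [arrivalTime_eq hy hw hn, cycleTime_eq hy hw hn]
  have key' : ∀ y : ℝ, 0 ≤ y → ∀ i, ∀ᵐ ω ∂P,
      arrivalTime y (fun k => τ i k ω) = cycleTime y fun k => τ i k ω := by
    intro y hy i
    have := key y hy
    rw [← h.map_row i] at this
    exact ae_of_ae_map (h.measurable_row i).aemeasurable this
  filter_upwards [key' x hx 0, ae_all_iff.2 (key' 0 le_rfl)] with ω h₀ h₁
  simp only [absorptionTimeRV, absorptionTime, totalTime, h₀, h₁]
  congr 1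
  split_ifs with hM
  · rw [Finset.range_eq_Ico, Finset.sum_Ico_add' (fun i => cycleTime 0 fun k => τ i k ω)]
    rfl
  · rw [show M ω - 1 = 0 by omega]; simp

lemma aemeasurable_absorptionTimeRV [IsProbabilityMeasure P] (hmu : 0 < mu) (hlam : mu < lam)
    (hM : Measurable M)
    (h : IsTelegraphDurations P lam mu M τ) {x : ℝ} (hx : 0 ≤ x) :
    AEMeasurable (absorptionTimeRV x M τ) P :=
  ⟨_, (measurable_totalTime_uncurry x).comp (hM.prodMk h.measurable_array),
    absorptionTimeRV_ae_eq hmu hlam h hx⟩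

/-- Exponential moments of the absorption time: each of the `M` cycles contributes a factor
`(mu + r) / mu`, and the first one in addition `exp ((s + r) x)`. -/
theorem lintegral_exp_absorptionTimeRV [IsProbabilityMeasure P] (hmu : 0 < mu) (hlam : mu < lam)
    (hM : IsLightTailedCount P M) (h : IsTelegraphDurations P lam mu M τ) {s r r' : ℝ}
    (h₂ : 0 < mu + r) (hroot : (lam - (2 * s + r)) * (mu + r) = lam * mu) (hrr' : r ≤ r')
    (h₁' : 2 * s + r' < lam) (hr' : lam * mu < (lam - (2 * s + r')) * (mu + r')) {x : ℝ}
    (hx : 0 ≤ x) :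
    ∫⁻ ω, ENNReal.ofReal (Real.exp (s * absorptionTimeRV x M τ ω)) ∂P =
      ENNReal.ofReal (Real.exp ((s + r) * x)) *
        ∫⁻ ω, ENNReal.ofReal (((mu + r) / mu) ^ M ω) ∂P := by
  have hq : 0 < (mu + r) / mu := by positivity
  have hrows := iIndepFun_rows (fun i k => h.measurable i k) h.indep
  let g : ℝ → (ℕ → ℝ) → ℝ≥0∞ := fun y w => ENNReal.ofReal (Real.exp (s * cycleTime y w))
  have hg : ∀ y, Measurable (g y) := fun y => by
    have := measurable_cycleTime y
    fun_prop
  have hgint : ∀ y : ℝ, 0 ≤ y → ∀ i, ∫⁻ ω, g y (fun k => τ i k ω) ∂P =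
      ENNReal.ofReal ((mu + r) / mu * Real.exp ((s + r) * y)) := fun y hy i => by
    rw [← lintegral_exp_cycleTime hmu hlam h₂ hroot hrr' h₁' hr' hy, ← h.map_row i,
      lintegral_map (hg y) (h.measurable_row i)]
  have hfix : ∀ m : ℕ, ∫⁻ ω, ENNReal.ofReal
      (Real.exp (s * totalTime x (m + 1) fun i k => τ i k ω)) ∂P =
      ENNReal.ofReal (Real.exp ((s + r) * x)) * ENNReal.ofReal (((mu + r) / mu) ^ (m + 1)) := by
    intro m
    let y : ℕ → ℝ := fun i => if i = 0 then x else 0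
    have hy : ∀ i, 0 ≤ y i := fun i => by simp only [y]; split_ifs <;> simp [hx]
    have hprod : ∀ ω, ENNReal.ofReal (Real.exp (s * totalTime x (m + 1) fun i k => τ i k ω)) =
        ∏ i ∈ Finset.range (m + 1), g (y i) fun k => τ i k ω := fun ω => by
      simp only [g]
      rw [← ENNReal.ofReal_prod_of_nonneg fun i _ => Real.exp_nonneg _, ← Real.exp_sum,
        ← Finset.mul_sum, Finset.sum_range_succ']
      simp [totalTime, y, add_comm]
    simp_rw [hprod]
    rw [lintegral_prod_eq_prod_lintegral_of_indepFun _ (fun i ω => g (y i) fun k => τ i k ω)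
      (hrows.comp (fun i => g (y i)) fun i => hg _) fun i => (hg _).comp (h.measurable_row i)]
    simp_rw [hgint _ (hy _)]
    rw [Finset.prod_range_succ', ← ENNReal.ofReal_mul (Real.exp_nonneg _), pow_succ,
      ENNReal.ofReal_mul (Real.exp_nonneg _), ENNReal.ofReal_mul (by positivity),
      ENNReal.ofReal_mul (by positivity), ENNReal.ofReal_pow (by positivity)]
    simp [y]
    ring
  have hind : IndepFun M (fun ω i k => τ i k ω) P :=
    (h.indep_count.comp (φ := fun (f : ℕ × ℕ → ℝ) i k => f (i, k)) (ψ := id) (by fun_prop)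
      measurable_id).symm
  have hmeas : Measurable (Function.uncurry fun (m : ℕ) (t : ℕ → ℕ → ℝ) =>
      ENNReal.ofReal (Real.exp (s * totalTime x m t))) := by
    have := measurable_totalTime_uncurry x
    exact ((this.const_mul s).exp).ennreal_ofReal
  rw [lintegral_congr_ae ((absorptionTimeRV_ae_eq hmu hlam h hx).mono fun ω hω => by rw [hω]),
    lintegral_comp_prodMk_of_indepFun hM.measurable h.measurable_array hind hmeas,
    ← lintegral_const_mul' _ _ ENNReal.ofReal_ne_top]
  refine lintegral_congr_ae (hM.pos.mono fun ω hω => ?_)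
  obtain ⟨m, hm⟩ : ∃ m, M ω = m + 1 := ⟨M ω - 1, by omega⟩
  simp only [hm]
  rw [lintegral_map (by
    have := measurable_totalTime x (m + 1)
    fun_prop) h.measurable_array, hfix]

end Absorption

/-! ### Large deviations from quadratic limits of scaled cumulants -/

/-- The scaled cumulant generating functions `(v r)⁻¹ log E[exp (θ v(r) Z_r)]` converge to
`σ θ² / 2` for all real `θ`, in the form of bounds on the exponential moments themselves (so that
their finiteness is part of the notion). -/
def HasQuadraticCumulants {Ω : Type*} [MeasurableSpace Ω] (P : Measure Ω) (Z : ℝ → Ω → ℝ)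
    (v : ℝ → ℝ) (σ : ℝ) : Prop :=
  ∀ θ η : ℝ, 0 < η → ∀ᶠ r in atTop,
    ENNReal.ofReal (Real.exp (v r * (σ * θ ^ 2 / 2 - η))) ≤
        ∫⁻ ω, ENNReal.ofReal (Real.exp (θ * v r * Z r ω)) ∂P ∧
      ∫⁻ ω, ENNReal.ofReal (Real.exp (θ * v r * Z r ω)) ∂P ≤
        ENNReal.ofReal (Real.exp (v r * (σ * θ ^ 2 / 2 + η)))

/-- Constant prefactors do not matter on the logarithmic scale (upper bounds). -/
lemma limsup_inv_mul_log_le {v : ℝ → ℝ} (hv : Tendsto v atTop atTop) {p : ℝ → ℝ≥0∞} {b : ℝ}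
    (h : ∀ δ > 0, ∀ᶠ r in atTop, p r ≤ ENNReal.ofReal (2 * Real.exp (v r * (b + δ)))) :
    limsup (fun r => ((1 / v r : ℝ) : EReal) * ENNReal.log (p r)) atTop ≤ (b : EReal) := by
  refine EReal.le_of_forall_lt_iff_le.1 fun c hc => ?_
  have hc : b < c := by exact_mod_cast hc
  refine limsup_le_of_le (by isBoundedDefault) ?_
  filter_upwards [h ((c - b) / 2) (by linarith), hv.eventually_gt_atTop 0,
    hv.eventually_ge_atTop (Real.log 2 / ((c - b) / 2))] with r hr hv0 hv1
  have hv1 : Real.log 2 ≤ v r * ((c - b) / 2) := (div_le_iff₀ (by linarith)).1 hv1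
  calc ((1 / v r : ℝ) : EReal) * ENNReal.log (p r)
      ≤ ((1 / v r : ℝ) : EReal) *
          ((Real.log (2 * Real.exp (v r * (b + (c - b) / 2))) : ℝ) : EReal) := by
        rw [← ENNReal.log_ofReal_of_pos (by positivity)]
        exact mul_le_mul_of_nonneg_left (ENNReal.log_monotone hr)
          (by exact_mod_cast (by positivity : 0 ≤ 1 / v r))
    _ ≤ (c : EReal) := by
        rw [← EReal.coe_mul, EReal.coe_le_coe_iff, Real.log_mul (by norm_num)
          (Real.exp_pos _).ne', Real.log_exp, one_div, inv_mul_le_iff₀ hv0]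
        linarith

/-- Constant prefactors do not matter on the logarithmic scale (lower bounds). -/
lemma le_liminf_inv_mul_log {v : ℝ → ℝ} (hv : Tendsto v atTop atTop) {p : ℝ → ℝ≥0∞} {b : ℝ}
    (h : ∀ δ > 0, ∀ᶠ r in atTop, ENNReal.ofReal (Real.exp (v r * (b - δ)) / 2) ≤ p r) :
    (b : EReal) ≤ liminf (fun r => ((1 / v r : ℝ) : EReal) * ENNReal.log (p r)) atTop := by
  refine EReal.ge_of_forall_gt_iff_ge.1 fun c hc => ?_
  have hc : c < b := by exact_mod_cast hc
  refine le_liminf_of_le (by isBoundedDefault) ?_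
  filter_upwards [h ((b - c) / 2) (by linarith), hv.eventually_gt_atTop 0,
    hv.eventually_ge_atTop (Real.log 2 / ((b - c) / 2))] with r hr hv0 hv1
  have hv1 : Real.log 2 ≤ v r * ((b - c) / 2) := (div_le_iff₀ (by linarith)).1 hv1
  calc (c : EReal) ≤ ((1 / v r : ℝ) : EReal) *
          ((Real.log (Real.exp (v r * (b - (b - c) / 2)) / 2) : ℝ) : EReal) := by
        rw [← EReal.coe_mul, EReal.coe_le_coe_iff, Real.log_div (Real.exp_pos _).ne'
          (by norm_num), Real.log_exp, one_div, le_inv_mul_iff₀ hv0]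
        linarith
    _ ≤ ((1 / v r : ℝ) : EReal) * ENNReal.log (p r) := by
        rw [← ENNReal.log_ofReal_of_pos (by positivity)]
        exact mul_le_mul_of_nonneg_left (ENNReal.log_monotone hr)
          (by exact_mod_cast (by positivity : 0 ≤ 1 / v r))

section LDP

variable {Ω : Type*} [MeasurableSpace Ω] {P : Measure Ω}
  {Z : ℝ → Ω → ℝ} {v : ℝ → ℝ} {σ : ℝ}

/-- The exponential Markov inequality. -/
lemma measure_le_exp_mul_lintegral {Y : Ω → ℝ} (hY : AEMeasurable Y P) (c : ℝ) :
    P {ω | c ≤ Y ω} ≤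
      ENNReal.ofReal (Real.exp (-c)) * ∫⁻ ω, ENNReal.ofReal (Real.exp (Y ω)) ∂P := by
  have h := mul_meas_ge_le_lintegral₀ (μ := P) (f := fun ω => ENNReal.ofReal (Real.exp (Y ω)))
    (by fun_prop) (ENNReal.ofReal (Real.exp c))
  have hsub : {ω | c ≤ Y ω} ⊆
      {ω | ENNReal.ofReal (Real.exp c) ≤ ENNReal.ofReal (Real.exp (Y ω))} := fun ω hω =>
    ENNReal.ofReal_le_ofReal (Real.exp_le_exp.2 hω)
  calc P {ω | c ≤ Y ω}
      = ENNReal.ofReal (Real.exp (-c)) * (ENNReal.ofReal (Real.exp c) * P {ω | c ≤ Y ω}) := by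
        rw [← mul_assoc, ← ENNReal.ofReal_mul (Real.exp_nonneg _), ← Real.exp_add]
        simp
    _ ≤ _ := by
        gcongr
        exact (mul_le_mul_right (measure_mono hsub) _).trans h

lemma HasQuadraticCumulants.measure_abs_ge_le (h : HasQuadraticCumulants P Z v σ) (hσ : 0 < σ)
    (hZ : ∀ r : ℝ, 0 < r → AEMeasurable (Z r) P) {d : ℝ} {δ : ℝ} (hδ : 0 < δ) (hd : 0 ≤ d)
    (hv : Tendsto v atTop atTop) :
    ∀ᶠ r in atTop, P {ω | d ≤ |Z r ω|} ≤
      ENNReal.ofReal (2 * Real.exp (v r * (-(d ^ 2 / (2 * σ)) + δ))) := by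
  -- `θ = ± d / σ` minimises `σ θ² / 2 ∓ θ d`
  filter_upwards [h (d / σ) δ hδ, h (-(d / σ)) δ hδ, eventually_gt_atTop 0,
    hv.eventually_ge_atTop 0] with r h₁ h₂ hr hvr
  have tail : ∀ θ : ℝ, |θ| = d / σ →
      ∫⁻ ω, ENNReal.ofReal (Real.exp (θ * v r * Z r ω)) ∂P ≤
        ENNReal.ofReal (Real.exp (v r * (σ * θ ^ 2 / 2 + δ))) →
      P {ω | d / σ * v r * d ≤ θ * v r * Z r ω} ≤
        ENNReal.ofReal (Real.exp (v r * (-(d ^ 2 / (2 * σ)) + δ))) := by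
    intro θ hθ hle
    have := hZ r hr
    refine (measure_le_exp_mul_lintegral (by fun_prop) _).trans
      ((mul_le_mul_right hle _).trans_eq ?_)
    rw [← ENNReal.ofReal_mul (Real.exp_nonneg _), ← Real.exp_add]
    congr 2
    rw [← sq_abs θ, hθ]
    field_simp
    ring
  have habs : |d / σ| = d / σ := abs_of_nonneg (by positivity)
  have hsub : {ω | d ≤ |Z r ω|} ⊆ {ω | d / σ * v r * d ≤ d / σ * v r * Z r ω} ∪
      {ω | d / σ * v r * d ≤ -(d / σ) * v r * Z r ω} := by
    intro ω hω
    have hω : d ≤ |Z r ω| := hω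
    have hnn : 0 ≤ d / σ * v r := by positivity
    rcases le_abs.1 hω with h' | h'
    · exact Or.inl (mul_le_mul_of_nonneg_left h' hnn)
    · refine Or.inr ?_
      have := mul_le_mul_of_nonneg_left h' hnn
      simp only [Set.mem_ofPred_eq]
      linarith
  refine (measure_mono hsub).trans ((measure_union_le _ _).trans ?_)
  rw [two_mul, ENNReal.ofReal_add (Real.exp_nonneg _) (Real.exp_nonneg _)]
  exact add_le_add (tail _ habs h₁.2) (tail _ (by rw [abs_neg, habs]) h₂.2)

/-- The tilted law at `θ = z / σ` concentrates at `z`: the exponential moments at `θ ± δ / σ` show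
that the part of `E[exp (θ v Z)]` outside the ball is negligible. -/
lemma HasQuadraticCumulants.le_measure_ball [IsProbabilityMeasure P]
    (h : HasQuadraticCumulants P Z v σ) (hσ : 0 < σ)
    (hZ : ∀ r : ℝ, 0 < r → AEMeasurable (Z r) P) (hv : Tendsto v atTop atTop) (z : ℝ) {δ η : ℝ}
    (hδ : 0 < δ) (hη : 0 < η) (hηδ : η ≤ δ ^ 2 / (8 * σ)) :
    ∀ᶠ r in atTop, ENNReal.ofReal
        (Real.exp (v r * (-(z ^ 2 / (2 * σ)) - (|z / σ| * δ + η))) / 2) ≤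
      P {ω | |Z r ω - z| < δ} := by
  set θ := z / σ with hθ
  set t := δ / σ with ht
  have ht0 : 0 < t := by positivity
  filter_upwards [h θ η hη, h (θ + t) η hη, h (θ - t) η hη, eventually_gt_atTop 0,
    hv.eventually_gt_atTop 0, hv.eventually_ge_atTop (Real.log 4 / (δ ^ 2 / (4 * σ)))]
    with r h₀ h₁ h₂ hr hv0 hv1
  have hv1 : Real.log 4 ≤ v r * (δ ^ 2 / (4 * σ)) := (div_le_iff₀ (by positivity)).1 hv1
  have hZr := hZ r hr
  set A : Set Ω := {ω | |Z r ω - z| < δ} with hA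
  let E : ℝ → Ω → ℝ≥0∞ := fun a ω => ENNReal.ofReal (Real.exp (a * v r * Z r ω))
  have hEm : ∀ a, AEMeasurable (E a) P := fun a => by fun_prop
  have hpt : ∀ ω, E θ ω ≤
      A.indicator (fun _ => ENNReal.ofReal (Real.exp (v r * (θ * z + |θ| * δ)))) ω +
        (ENNReal.ofReal (Real.exp (-(t * v r * (z + δ)))) * E (θ + t) ω +
          ENNReal.ofReal (Real.exp (t * v r * (z - δ))) * E (θ - t) ω) := by
    intro ω
    simp only [E]
    rw [← ENNReal.ofReal_mul (Real.exp_nonneg _), ← ENNReal.ofReal_mul (Real.exp_nonneg _),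
      ← Real.exp_add, ← Real.exp_add]
    by_cases hω : ω ∈ A
    · rw [Set.indicator_of_mem hω]
      refine le_add_right (ENNReal.ofReal_le_ofReal (Real.exp_le_exp.2 ?_))
      have h' : θ * (Z r ω - z) ≤ |θ| * δ :=
        (le_abs_self _).trans ((abs_mul _ _).trans_le (mul_le_mul_of_nonneg_left
          (show |Z r ω - z| < δ from hω).le (abs_nonneg _)))
      have := mul_le_mul_of_nonneg_left h' hv0.le
      linarith
    · rw [Set.indicator_of_notMem hω, zero_add]
      have htv : 0 ≤ t * v r := by positivity
      rcases le_abs.1 (not_lt.1 (show ¬ |Z r ω - z| < δ from hω)) with h' | h'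
      · refine le_add_right (ENNReal.ofReal_le_ofReal (Real.exp_le_exp.2 ?_))
        have := mul_le_mul_of_nonneg_left h' htv
        linarith
      · refine le_add_left (ENNReal.ofReal_le_ofReal (Real.exp_le_exp.2 ?_))
        have := mul_le_mul_of_nonneg_left h' htv
        linarith
  have hint := lintegral_mono (μ := P) hpt
  have hm : AEMeasurable (fun ω =>
      ENNReal.ofReal (Real.exp (-(t * v r * (z + δ)))) * E (θ + t) ω +
        ENNReal.ofReal (Real.exp (t * v r * (z - δ))) * E (θ - t) ω) P :=
    ((hEm _).const_mul _).add ((hEm _).const_mul _)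
  rw [lintegral_add_right' _ hm,
    lintegral_add_left' ((hEm _).const_mul _), lintegral_const_mul' _ _ ENNReal.ofReal_ne_top,
    lintegral_const_mul' _ _ ENNReal.ofReal_ne_top] at hint
  have hbd := h₀.1.trans (hint.trans (add_le_add (lintegral_indicator_const_le _ _)
    (add_le_add (mul_le_mul_right h₁.2 _) (mul_le_mul_right h₂.2 _))))
  rw [← ENNReal.ofReal_mul (Real.exp_nonneg _), ← ENNReal.ofReal_mul (Real.exp_nonneg _),
    ← Real.exp_add, ← Real.exp_add, ← ofReal_measureReal (μ := P) (s := A),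
    ← ENNReal.ofReal_mul (Real.exp_nonneg _),
    ← ENNReal.ofReal_add (Real.exp_nonneg _) (Real.exp_nonneg _),
    ← ENNReal.ofReal_add (by positivity) (by positivity),
    ENNReal.ofReal_le_ofReal_iff (by positivity)] at hbd
  rw [← ofReal_measureReal (μ := P) (s := A)]
  refine ENNReal.ofReal_le_ofReal ?_
  have hz : z = σ * θ := by rw [hθ]; field_simp
  have hd : δ = σ * t := by rw [ht]; field_simp
  set X := v r * (σ * θ ^ 2 / 2 - η) with hX
  have e₁ : -(t * v r * (z + δ)) + v r * (σ * (θ + t) ^ 2 / 2 + η) ≤ X - Real.log 4 := by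
    have : δ ^ 2 / (8 * σ) = σ * t ^ 2 / 8 := by rw [hd]; field_simp
    have h4 : δ ^ 2 / (4 * σ) = σ * t ^ 2 / 4 := by rw [hd]; field_simp
    rw [this] at hηδ
    rw [h4] at hv1
    have := mul_le_mul_of_nonneg_left hηδ hv0.le
    rw [hX, hz, hd]
    nlinarith
  have e₂ : t * v r * (z - δ) + v r * (σ * (θ - t) ^ 2 / 2 + η) ≤ X - Real.log 4 := by
    refine le_trans (le_of_eq ?_) e₁
    rw [hz]; ring
  have e₃ : Real.exp (X - Real.log 4) = Real.exp X / 4 := by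
    rw [Real.exp_sub, Real.exp_log (by norm_num)]
  have f₁ := (Real.exp_le_exp.2 e₁).trans_eq e₃
  have f₂ := (Real.exp_le_exp.2 e₂).trans_eq e₃
  have hmain : Real.exp X / 2 ≤ Real.exp (v r * (θ * z + |θ| * δ)) * P.real A := by linarith
  have e₄ : v r * (-(z ^ 2 / (2 * σ)) - (|θ| * δ + η)) = X - v r * (θ * z + |θ| * δ) := by
    have : z ^ 2 / (2 * σ) = σ * θ ^ 2 / 2 := by rw [hz]; field_simp
    rw [this, hX, hz]; ring
  rw [e₄, Real.exp_sub, div_right_comm, div_le_iff₀' (Real.exp_pos _)]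
  exact hmain

/-- A Gärtner–Ellis theorem for quadratic limits: these bounds on the exponential moments suffice
for the full large deviation principle. -/
theorem HasQuadraticCumulants.satisfiesLDP [IsProbabilityMeasure P]
    (h : HasQuadraticCumulants P Z v σ) (hσ : 0 < σ)
    (hZ : ∀ r : ℝ, 0 < r → AEMeasurable (Z r) P) (hv : Tendsto v atTop atTop) {I : ℝ → ℝ≥0∞}
    (hI : ∀ z, I z = ENNReal.ofReal (z ^ 2 / (2 * σ))) : SatisfiesLDP P Z v I where
  aemeasurable := hZ
  speed := hv
  lowerSemicontinuous := by
    rw [funext hI]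
    exact (ENNReal.continuous_ofReal.comp (by fun_prop)).lowerSemicontinuous
  upper_bound F hF := by
    have hIc : ∀ z : ℝ, (I z : EReal) = ((z ^ 2 / (2 * σ) : ℝ) : EReal) := fun z => by
      rw [hI, EReal.coe_ennreal_ofReal, max_eq_left (by positivity)]
    rcases F.eq_empty_or_nonempty with rfl | hne
    · refine limsup_le_of_le (by isBoundedDefault) ?_
      filter_upwards [hv.eventually_gt_atTop 0] with r hr
      rw [Set.preimage_empty, measure_empty, ENNReal.log_zero,
        EReal.coe_mul_bot_of_pos (by positivity)]
      exact bot_le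
    · obtain ⟨z, hzF, hz⟩ := hF.exists_infDist_eq_dist hne 0
      have hmin : ∀ y ∈ F, |z| ≤ |y| := fun y hy => by
        have := Metric.infDist_le_dist_of_mem (x := (0 : ℝ)) hy
        rw [hz] at this
        simpa using this
      refine le_trans ?_ (EReal.neg_le_neg_iff.2 (iInf₂_le z hzF))
      rw [hIc, ← EReal.coe_neg]
      refine limsup_inv_mul_log_le hv fun δ hδ => ?_
      filter_upwards [h.measure_abs_ge_le hσ hZ hδ (abs_nonneg z) hv] with r hr
      rw [sq_abs] at hr
      have hsub : Z r ⁻¹' F ⊆ {ω | |z| ≤ |Z r ω|} := fun ω hω => hmin _ hω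
      exact (measure_mono hsub).trans hr
  lower_bound G hG := by
    have hIc : ∀ z : ℝ, (I z : EReal) = ((z ^ 2 / (2 * σ) : ℝ) : EReal) := fun z => by
      rw [hI, EReal.coe_ennreal_ofReal, max_eq_left (by positivity)]
    rw [EReal.neg_le]
    refine le_iInf₂ fun z hz => ?_
    rw [EReal.neg_le, hIc, ← EReal.coe_neg]
    obtain ⟨δ₀, hδ₀, hball⟩ := Metric.isOpen_iff.1 hG z hz
    refine le_liminf_inv_mul_log hv fun κ hκ => ?_
    obtain ⟨δ, hδ, hδδ₀, hδκ⟩ : ∃ δ > 0, δ ≤ δ₀ ∧ |z / σ| * δ ≤ κ / 2 := by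
      refine ⟨min δ₀ (κ / 2 / (|z / σ| + 1)), by positivity, min_le_left _ _, ?_⟩
      calc |z / σ| * min δ₀ (κ / 2 / (|z / σ| + 1))
          ≤ (|z / σ| + 1) * (κ / 2 / (|z / σ| + 1)) := by
            gcongr
            · linarith
            · exact min_le_right _ _
        _ = κ / 2 := by field_simp
    have hη : 0 < min (κ / 2) (δ ^ 2 / (8 * σ)) := by positivity
    filter_upwards [h.le_measure_ball hσ hZ hv z hδ hη (min_le_right _ _),
      hv.eventually_ge_atTop 0] with r hr hv0
    refine le_trans (ENNReal.ofReal_le_ofReal ?_) (hr.trans (measure_mono fun ω hω => hball ?_))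
    · have := min_le_left (κ / 2) (δ ^ 2 / (8 * σ))
      gcongr
      linarith
    · exact lt_of_lt_of_le (show |Z r ω - z| < δ from hω) hδδ₀

/-- A quadratic limit of the cumulants forces the means to tend to zero, by Jensen's inequality. -/
lemma HasQuadraticCumulants.tendsto_integral [IsProbabilityMeasure P]
    (h : HasQuadraticCumulants P Z v σ) (hσ : 0 < σ)
    (hZ : ∀ r : ℝ, 0 < r → Integrable (Z r) P) (hv : Tendsto v atTop atTop) :
    Tendsto (fun r => ∫ ω, Z r ω ∂P) atTop (𝓝 0) := by
  have jensen : ∀ θ η : ℝ, 0 < η → ∀ᶠ r in atTop, θ * ∫ ω, Z r ω ∂P ≤ σ * θ ^ 2 / 2 + η := by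
    intro θ η hη
    filter_upwards [h θ η hη, eventually_gt_atTop 0, hv.eventually_gt_atTop 0] with r hr hr0 hv0
    have hZr := hZ r hr0
    have hm := hZr.aestronglyMeasurable.aemeasurable
    have hint : Integrable (fun ω => Real.exp (θ * v r * Z r ω)) P := by
      refine ⟨by fun_prop, ?_⟩
      rw [hasFiniteIntegral_iff_ofReal (ae_of_all _ fun ω => Real.exp_nonneg _)]
      exact hr.2.trans_lt ENNReal.ofReal_lt_top
    have hle := hr.2
    rw [← ofReal_integral_eq_lintegral_ofReal hint (ae_of_all _ fun ω => Real.exp_nonneg _),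
      ENNReal.ofReal_le_ofReal_iff (Real.exp_nonneg _)] at hle
    have hj := convexOn_exp.map_integral_le (μ := P) Real.continuous_exp.continuousOn isClosed_univ
      (ae_of_all _ fun _ => Set.mem_univ _) (hZr.const_mul (θ * v r)) hint
    have := Real.exp_le_exp.1 (hj.trans hle)
    rw [integral_const_mul, mul_comm θ, mul_assoc] at this
    exact le_of_mul_le_mul_left this hv0
  rw [Metric.tendsto_nhds]
  intro κ hκ
  filter_upwards [jensen (κ / σ) (κ ^ 2 / (4 * σ)) (by positivity),
    jensen (-(κ / σ)) (κ ^ 2 / (4 * σ)) (by positivity)] with r h₁ h₂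
  have e : ∀ a : ℝ, κ / σ * a ≤ 3 / 4 * κ * (κ / σ) → a < κ := fun a ha => by
    have hp : 0 < κ / σ := by positivity
    have : a ≤ 3 / 4 * κ := le_of_mul_le_mul_left (by linarith) hp
    linarith
  have e' : σ * (κ / σ) ^ 2 / 2 + κ ^ 2 / (4 * σ) = 3 / 4 * κ * (κ / σ) := by field_simp; norm_num
  rw [Real.dist_eq, sub_zero, abs_lt]
  refine ⟨?_, e _ (by rwa [← e'])⟩
  have := e (-∫ ω, Z r ω ∂P) (by rw [← e', ← neg_sq (κ / σ)] at *; linarith)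
  linarith

/-- Centering does not change a quadratic limit of the cumulants. -/
lemma HasQuadraticCumulants.sub_integral [IsProbabilityMeasure P]
    (h : HasQuadraticCumulants P Z v σ) (hσ : 0 < σ)
    (hZ : ∀ r : ℝ, 0 < r → Integrable (Z r) P) (hv : Tendsto v atTop atTop) :
    HasQuadraticCumulants P (fun r ω => Z r ω - ∫ ω', Z r ω' ∂P) v σ := by
  intro θ η hη
  have hlim := (h.tendsto_integral hσ hZ hv).const_mul θ
  rw [mul_zero] at hlim
  filter_upwards [h θ (η / 2) (by linarith), hv.eventually_ge_atTop 0,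
    hlim.eventually (Ioo_mem_nhds (show -(η / 2) < 0 by linarith) (show 0 < η / 2 by linarith))]
    with r hr hv0 hm
  set m := ∫ ω', Z r ω' ∂P
  have e : ∀ ω, ENNReal.ofReal (Real.exp (θ * v r * (Z r ω - m))) =
      ENNReal.ofReal (Real.exp (-(v r * (θ * m)))) *
        ENNReal.ofReal (Real.exp (θ * v r * Z r ω)) := fun ω => by
    rw [← ENNReal.ofReal_mul (Real.exp_nonneg _), ← Real.exp_add]; congr 2; ring
  simp_rw [e]
  rw [lintegral_const_mul' _ _ ENNReal.ofReal_ne_top]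
  have b₁ := mul_le_mul_of_nonneg_left hm.1.le hv0
  have b₂ := mul_le_mul_of_nonneg_left hm.2.le hv0
  constructor
  · refine le_trans ?_ (mul_le_mul_right hr.1 _)
    rw [← ENNReal.ofReal_mul (Real.exp_nonneg _), ← Real.exp_add]
    refine ENNReal.ofReal_le_ofReal (Real.exp_le_exp.2 ?_)
    linarith
  · refine (mul_le_mul_right hr.2 _).trans ?_
    rw [← ENNReal.ofReal_mul (Real.exp_nonneg _), ← Real.exp_add]
    refine ENNReal.ofReal_le_ofReal (Real.exp_le_exp.2 ?_)
    linarith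

end LDP

lemma isGoodRateFunction_quadratic {σ : ℝ} (hσ : 0 < σ) {I : ℝ → ℝ≥0∞}
    (hI : ∀ z, I z = ENNReal.ofReal (z ^ 2 / (2 * σ))) : IsGoodRateFunction I := by
  have hc : Continuous I := by
    rw [funext hI]
    exact ENNReal.continuous_ofReal.comp (by fun_prop)
  refine ⟨hc.lowerSemicontinuous, fun η => ?_⟩
  refine Metric.isCompact_of_isClosed_isBounded (isClosed_le hc continuous_const) ?_
  refine (Metric.isBounded_Icc (-(2 * σ * η + 1)) (2 * σ * η + 1)).subset fun z hz => ?_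
  have hz : I z ≤ (η : ℝ≥0∞) := hz
  rw [hI, ← ENNReal.ofReal_coe_nnreal, ENNReal.ofReal_le_ofReal_iff η.coe_nonneg,
    div_le_iff₀ (by positivity)] at hz
  have : 0 ≤ σ * η := by positivity
  constructor <;> nlinarith

/-! ### The function `Λ` near the origin -/

section Lambda

variable {lam mu : ℝ}

/-- Interior of the effective domain of the moment generating function of a cycle. -/
def InDomain (lam mu s : ℝ) : Prop :=
  0 < lam + mu - 2 * s ∧ 0 < (lam + mu - 2 * s) ^ 2 - 4 * lam * mu

lemma eventually_inDomain (hmu : 0 < mu) (hlam : mu < lam) : ∀ᶠ s in 𝓝 0, InDomain lam mu s := by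
  have h₁ : Continuous fun s : ℝ => lam + mu - 2 * s := by fun_prop
  have h₂ : Continuous fun s : ℝ => (lam + mu - 2 * s) ^ 2 - 4 * lam * mu := by fun_prop
  exact (h₁.continuousAt.eventually_const_lt (by simp; linarith)).and
    (h₂.continuousAt.eventually_const_lt (by
      have : 0 < (lam - mu) ^ 2 := by have := sub_pos.2 hlam; positivity
      nlinarith))

lemma sqrt_disc_zero (hlam : mu < lam) :
    √((lam + mu - 2 * 0) ^ 2 - 4 * lam * mu) = lam - mu := by
  rw [show (lam + mu - 2 * 0) ^ 2 - 4 * lam * mu = (lam - mu) ^ 2 by ring,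
    Real.sqrt_sq (sub_pos.2 hlam).le]

lemma telegraphLambda_zero (hlam : mu < lam) : telegraphLambda lam mu 0 = 0 := by
  rw [telegraphLambda, sqrt_disc_zero hlam]; simp

lemma hasDerivAt_sqrt_disc {s : ℝ} (hs : InDomain lam mu s) :
    HasDerivAt (fun s => √((lam + mu - 2 * s) ^ 2 - 4 * lam * mu))
      (-2 * (lam + mu - 2 * s) / √((lam + mu - 2 * s) ^ 2 - 4 * lam * mu)) s := by
  have h₁ : HasDerivAt (fun s : ℝ => lam + mu - 2 * s) (-2) s := by
    simpa using ((hasDerivAt_id s).const_mul 2).const_sub (lam + mu)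
  convert! (((h₁.pow 2).sub_const (4 * lam * mu)).sqrt hs.2.ne') using 1
  have := (Real.sqrt_pos.2 hs.2).ne'
  field_simp
  norm_num

lemma hasDerivAt_telegraphLambda {s : ℝ} (hs : InDomain lam mu s) :
    HasDerivAt (telegraphLambda lam mu)
      ((lam + mu - 2 * s) / √((lam + mu - 2 * s) ^ 2 - 4 * lam * mu)) s := by
  have h := ((hasDerivAt_sqrt_disc hs).const_sub (lam - mu)).div_const 2
  convert! h using 1
  ring

lemma hasDerivAt_deriv_telegraphLambda (hmu : 0 < mu) (hlam : mu < lam) :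
    HasDerivAt (fun s => (lam + mu - 2 * s) / √((lam + mu - 2 * s) ^ 2 - 4 * lam * mu))
      (8 * lam * mu / (lam - mu) ^ 3) 0 := by
  have hs := (eventually_inDomain hmu hlam).self_of_nhds
  have h₁ : HasDerivAt (fun s : ℝ => lam + mu - 2 * s) (-2) 0 := by
    simpa using ((hasDerivAt_id (0 : ℝ)).const_mul 2).const_sub (lam + mu)
  convert! h₁.div (hasDerivAt_sqrt_disc hs) (Real.sqrt_pos.2 hs.2).ne' using 1
  rw [sqrt_disc_zero hlam]
  have := (sub_pos.2 hlam).ne'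
  field_simp
  ring

lemma iteratedDeriv_two_telegraphLambda (hmu : 0 < mu) (hlam : mu < lam) :
    iteratedDeriv 2 (telegraphLambda lam mu) 0 = 8 * lam * mu / (lam - mu) ^ 3 := by
  rw [iteratedDeriv_succ, iteratedDeriv_one]
  have h : deriv (telegraphLambda lam mu) =ᶠ[𝓝 0]
      fun s => (lam + mu - 2 * s) / √((lam + mu - 2 * s) ^ 2 - 4 * lam * mu) :=
    (eventually_inDomain hmu hlam).mono fun s hs => (hasDerivAt_telegraphLambda hs).deriv
  rw [h.deriv_eq, (hasDerivAt_deriv_telegraphLambda hmu hlam).deriv]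

/-- Second order expansion of `Λ` at the origin. -/
lemma telegraphLambda_isLittleO (hmu : 0 < mu) (hlam : mu < lam) :
    (fun s => telegraphLambda lam mu s - ((lam + mu) / (lam - mu) * s +
      8 * lam * mu / (lam - mu) ^ 3 * s ^ 2 / 2)) =o[𝓝 0] fun s => s ^ 2 := by
  set κ := 8 * lam * mu / (lam - mu) ^ 3
  set c := (lam + mu) / (lam - mu)
  obtain ⟨δ, hδ, hball⟩ := Metric.eventually_nhds_iff_ball.1 (eventually_inDomain hmu hlam)
  have hnhds : 𝓝[Metric.ball (0 : ℝ) δ] 0 = 𝓝 0 :=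
    Metric.isOpen_ball.nhdsWithin_eq (Metric.mem_ball_self hδ)
  have hd := (hasDerivAt_deriv_telegraphLambda hmu hlam).isLittleO
  have h := (convex_ball (0 : ℝ) δ).isLittleO_pow_succ_real (n := 1) (Metric.mem_ball_self hδ)
    (f := fun s => telegraphLambda lam mu s - (c * s + κ * s ^ 2 / 2))
    (f' := fun s => (lam + mu - 2 * s) / √((lam + mu - 2 * s) ^ 2 - 4 * lam * mu) - (c + κ * s))
    (fun s hs => by
      have h₂ : HasDerivAt (fun s : ℝ => c * s + κ * s ^ 2 / 2) (c + κ * s) s := by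
        convert! ((hasDerivAt_id s).const_mul c).add
          ((((hasDerivAt_id s).pow 2).const_mul κ).div_const 2) using 1
        simp
        ring
      exact ((hasDerivAt_telegraphLambda (hball s hs)).sub h₂).hasDerivWithinAt)
    (by
      rw [hnhds]
      convert! hd using 2 with s s
      · rw [sqrt_disc_zero hlam]
        simp [c]
        ring
      · simp)
  rw [hnhds] at h
  simpa [telegraphLambda_zero hlam] using h

/-- `r = Λ(s) - s` is the smaller root of `(lam - 2 s - r) (mu + r) = lam mu`, and the midpoint of
the two roots serves as the auxiliary exponent `r'`. -/
lemma root_telegraphLambda {s : ℝ} (hlam : 0 < lam) (hmu : 0 < mu) (hs : InDomain lam mu s) :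
    0 < mu + (telegraphLambda lam mu s - s) ∧
    (lam - (2 * s + (telegraphLambda lam mu s - s))) * (mu + (telegraphLambda lam mu s - s)) =
      lam * mu ∧
    telegraphLambda lam mu s - s ≤ (lam - mu - 2 * s) / 2 ∧
    2 * s + (lam - mu - 2 * s) / 2 < lam ∧
    lam * mu < (lam - (2 * s + (lam - mu - 2 * s) / 2)) * (mu + (lam - mu - 2 * s) / 2) := by
  obtain ⟨h₁, h₂⟩ := hs
  have hsq := Real.sq_sqrt h₂.le
  have hpos := Real.sqrt_pos.2 h₂
  set D := √((lam + mu - 2 * s) ^ 2 - 4 * lam * mu) with hD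
  have hlt : D < lam + mu - 2 * s := by
    refine lt_of_pow_lt_pow_left₀ 2 h₁.le ?_
    nlinarith [mul_pos hlam hmu]
  have e : telegraphLambda lam mu s - s = (lam - mu - 2 * s - D) / 2 := by
    rw [telegraphLambda, ← hD]; ring
  rw [e]
  refine ⟨by linarith, by nlinarith, by linarith, by linarith, by nlinarith⟩

lemma continuousAt_telegraphLambda (hmu : 0 < mu) (hlam : mu < lam) :
    ContinuousAt (telegraphLambda lam mu) 0 :=
  (hasDerivAt_telegraphLambda (eventually_inDomain hmu hlam).self_of_nhds).continuousAt

end Lambda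

/-! ### Moderate deviations of the absorption time -/

section Main

variable {Ω : Type*} [MeasurableSpace Ω] {P : Measure Ω} [IsProbabilityMeasure P] {lam mu : ℝ}
  {M : Ω → ℕ}

/-- Contribution of the number of cycles to the exponential moment of the absorption time. -/
noncomputable def countMoment (P : Measure Ω) (M : Ω → ℕ) (lam mu s : ℝ) : ℝ≥0∞ :=
  ∫⁻ ω, ENNReal.ofReal (((mu + (telegraphLambda lam mu s - s)) / mu) ^ M ω) ∂P


lemma exists_countMoment_bounds (hmu : 0 < mu) (hlam : mu < lam) (hM : IsLightTailedCount P M) :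
    ∃ b : ℝ, ∀ᶠ s in 𝓝 0, ENNReal.ofReal (Real.exp (-b)) ≤ countMoment P M lam mu s ∧
      countMoment P M lam mu s ≤ ENNReal.ofReal (Real.exp b) := by
  obtain ⟨s₀, hs₀, hint⟩ := hM.lightTailed
  have hMm := hM.measurable
  have hMr : Measurable fun ω => (M ω : ℝ) := by fun_prop
  set K : ℝ≥0∞ := ∫⁻ ω, ENNReal.ofReal (Real.exp (s₀ * M ω)) ∂P with hK
  set k : ℝ≥0∞ := ∫⁻ ω, ENNReal.ofReal (Real.exp (-(s₀ * M ω))) ∂P with hk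
  have hKtop : K ≠ ∞ := by
    rw [hK, ← ofReal_integral_eq_lintegral_ofReal hint (ae_of_all _ fun ω => Real.exp_nonneg _)]
    exact ENNReal.ofReal_ne_top
  have hkK : k ≤ K := lintegral_mono fun ω => by
    refine ENNReal.ofReal_le_ofReal (Real.exp_le_exp.2 ?_)
    have : 0 ≤ s₀ * (M ω : ℝ) := by positivity
    linarith
  have hktop : k ≠ ∞ := ne_top_of_le_ne_top hKtop hkK
  have hk0 : k ≠ 0 := by
    rw [hk, Ne, lintegral_eq_zero_iff (by fun_prop)]
    intro h
    obtain ⟨ω, hω⟩ := h.exists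
    exact absurd hω (by simp [Real.exp_pos])
  have hK0 : K ≠ 0 := fun h => hk0 (le_antisymm (h ▸ hkK) bot_le)
  have hq : ContinuousAt (fun s => (mu + (telegraphLambda lam mu s - s)) / mu) 0 :=
    (((continuousAt_telegraphLambda hmu hlam).sub continuousAt_id).const_add mu).div_const mu
  have hq0 : (fun s => (mu + (telegraphLambda lam mu s - s)) / mu) 0 = 1 := by
    simp [telegraphLambda_zero hlam, hmu.ne']
  refine ⟨max (Real.log K.toReal) (-Real.log k.toReal), ?_⟩
  filter_upwards [hq.eventually_lt_const (show _ < Real.exp s₀ by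
      rw [hq0]; exact Real.one_lt_exp_iff.2 hs₀),
    hq.eventually_const_lt (show Real.exp (-s₀) < _ by
      rw [hq0]; exact Real.exp_lt_one_iff.2 (by linarith))] with s h₁ h₂
  have hpow : ∀ (a : ℝ) (m : ℕ), Real.exp (a * m) = Real.exp a ^ m := fun a m => by
    rw [mul_comm, Real.exp_nat_mul]
  constructor
  · calc ENNReal.ofReal (Real.exp (-max (Real.log K.toReal) (-Real.log k.toReal)))
        ≤ ENNReal.ofReal (Real.exp (Real.log k.toReal)) := by
          refine ENNReal.ofReal_le_ofReal (Real.exp_le_exp.2 ?_)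
          linarith [le_max_right (Real.log K.toReal) (-Real.log k.toReal)]
      _ = k := by rw [Real.exp_log (ENNReal.toReal_pos hk0 hktop), ENNReal.ofReal_toReal hktop]
      _ ≤ _ := lintegral_mono fun ω => by
          refine ENNReal.ofReal_le_ofReal ?_
          rw [← neg_mul, hpow]
          exact pow_le_pow_left₀ (Real.exp_nonneg _) h₂.le _
  · calc countMoment P M lam mu s ≤ K := lintegral_mono fun ω => by
          refine ENNReal.ofReal_le_ofReal ?_
          rw [hpow]
          exact pow_le_pow_left₀ ((Real.exp_nonneg _).trans h₂.le) h₁.le _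
      _ = ENNReal.ofReal (Real.exp (Real.log K.toReal)) := by
          rw [Real.exp_log (ENNReal.toReal_pos hK0 hKtop), ENNReal.ofReal_toReal hKtop]
      _ ≤ _ := ENNReal.ofReal_le_ofReal (Real.exp_le_exp.2 (le_max_left _ _))

lemma lintegral_exp_absorptionTimeRV_eq (hmu : 0 < mu) (hlam : mu < lam)
    (hM : IsLightTailedCount P M) {τ : ℕ → ℕ → Ω → ℝ} (h : IsTelegraphDurations P lam mu M τ)
    {s : ℝ} (hs : InDomain lam mu s) {x : ℝ} (hx : 0 ≤ x) :
    ∫⁻ ω, ENNReal.ofReal (Real.exp (s * absorptionTimeRV x M τ ω)) ∂P =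
      ENNReal.ofReal (Real.exp (telegraphLambda lam mu s * x)) * countMoment P M lam mu s := by
  obtain ⟨h₁, h₂, h₃, h₄, h₅⟩ := root_telegraphLambda (hmu.trans hlam) hmu hs
  rw [lintegral_exp_absorptionTimeRV hmu hlam hM h h₁ h₂ h₃ h₄ h₅ hx, add_sub_cancel, countMoment]

lemma integrable_absorptionTimeRV (hmu : 0 < mu) (hlam : mu < lam)
    (hM : IsLightTailedCount P M) {τ : ℕ → ℕ → Ω → ℝ} (h : IsTelegraphDurations P lam mu M τ)
    {x : ℝ} (hx : 0 ≤ x) : Integrable (absorptionTimeRV x M τ) P := by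
  refine integrable_of_mem_interior_integrableExpSet (mem_interior_iff_mem_nhds.2 ?_)
  obtain ⟨b, hb⟩ := exists_countMoment_bounds hmu hlam hM
  filter_upwards [eventually_inDomain hmu hlam, hb] with s hs hbs
  have := aemeasurable_absorptionTimeRV hmu hlam hM.measurable h hx
  refine ⟨by fun_prop, ?_⟩
  rw [hasFiniteIntegral_iff_ofReal (ae_of_all _ fun ω => Real.exp_nonneg _),
    lintegral_exp_absorptionTimeRV_eq hmu hlam hM h hs hx]
  exact ENNReal.mul_lt_top ENNReal.ofReal_lt_top (hbs.2.trans_lt ENNReal.ofReal_lt_top)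

/-- Centered at `Λ'(0) x = (lam + mu) / (lam - mu) x`, the absorption time has quadratic scaled
cumulants: the exponent `θ` corresponds to the argument `s = θ / √(x ε_x) → 0` of `Λ`. -/
lemma hasQuadraticCumulants_absorptionTimeRV (hmu : 0 < mu) (hlam : mu < lam)
    (hM : IsLightTailedCount P M) {τ : ℝ → ℕ → ℕ → Ω → ℝ}
    (hτ : ∀ x : ℝ, 0 < x → IsTelegraphDurations P lam mu M (τ x))
    {ε : ℝ → ℝ} (hε_pos : ∀ x : ℝ, 0 < x → 0 < ε x) (hε_zero : Tendsto ε atTop (𝓝 0))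
    (hε_top : Tendsto (fun x : ℝ => x * ε x) atTop atTop) :
    HasQuadraticCumulants P
      (fun x ω => (absorptionTimeRV x M (τ x) ω - (lam + mu) / (lam - mu) * x) / √(x / ε x))
      (fun x => 1 / ε x) (8 * lam * mu / (lam - mu) ^ 3) := by
  intro θ η hη
  set κ := 8 * lam * mu / (lam - mu) ^ 3
  set c := (lam + mu) / (lam - mu)
  obtain ⟨b, hb⟩ := exists_countMoment_bounds hmu hlam hM
  have hs : Tendsto (fun x => θ / √(x * ε x)) atTop (𝓝 0) :=
    (Real.tendsto_sqrt_atTop.comp hε_top).const_div_atTop θ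
  have hη' : 0 < η / 2 / (θ ^ 2 + 1) := by positivity
  have hεb : Tendsto (fun x => ε x * b) atTop (𝓝 0) := by simpa using hε_zero.mul_const b
  filter_upwards [hs.eventually (eventually_inDomain hmu hlam), hs.eventually hb,
    hs.eventually ((telegraphLambda_isLittleO hmu hlam).bound hη'), eventually_gt_atTop 0,
    hεb.eventually_lt_const (show 0 < η / 2 by linarith)] with x h₁ h₂ h₃ hx hbx
  have hε := hε_pos x hx
  set s := θ / √(x * ε x) with hsdef
  have hsq : x * s ^ 2 = θ ^ 2 / ε x := by
    rw [hsdef, div_pow, Real.sq_sqrt (by positivity)]; field_simp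
  have hscale : θ * (1 / ε x) / √(x / ε x) = s := by
    have : √(x / ε x) = √(x * ε x) / ε x := by
      rw [show x / ε x = x * ε x / ε x ^ 2 by field_simp, Real.sqrt_div (by positivity),
        Real.sqrt_sq hε.le]
    rw [this, hsdef]
    have : √(x * ε x) ≠ 0 := (Real.sqrt_pos.2 (by positivity)).ne'
    field_simp
  have e : ∀ ω, ENNReal.ofReal (Real.exp (θ * (1 / ε x) *
      ((absorptionTimeRV x M (τ x) ω - c * x) / √(x / ε x)))) =
      ENNReal.ofReal (Real.exp (-(s * (c * x)))) *
        ENNReal.ofReal (Real.exp (s * absorptionTimeRV x M (τ x) ω)) := fun ω => by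
    rw [← ENNReal.ofReal_mul (Real.exp_nonneg _), ← Real.exp_add, ← hscale]; congr 2; ring
  simp_rw [e]
  rw [lintegral_const_mul' _ _ ENNReal.ofReal_ne_top,
    lintegral_exp_absorptionTimeRV_eq hmu hlam hM (hτ x hx) h₁ hx.le, ← mul_assoc,
    ← ENNReal.ofReal_mul (Real.exp_nonneg _), ← Real.exp_add]
  rw [Real.norm_eq_abs, Real.norm_eq_abs, abs_of_nonneg (sq_nonneg s)] at h₃
  -- the error in the expansion of `Λ` is at most `η / (2 ε)`
  have hrem : x * (η / 2 / (θ ^ 2 + 1) * s ^ 2) ≤ 1 / ε x * (η / 2) := by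
    rw [mul_left_comm, hsq, show η / 2 / (θ ^ 2 + 1) * (θ ^ 2 / ε x) =
      1 / ε x * (η / 2 * (θ ^ 2 / (θ ^ 2 + 1))) by field_simp]
    have : θ ^ 2 / (θ ^ 2 + 1) ≤ 1 := (div_le_one (by positivity)).2 (by linarith)
    gcongr
    nlinarith
  have hbb : b ≤ 1 / ε x * (η / 2) := by
    rw [one_div, le_inv_mul_iff₀ hε]; exact hbx.le
  have hmain : x * (κ * s ^ 2 / 2) = 1 / ε x * (κ * θ ^ 2 / 2) := by
    rw [show x * (κ * s ^ 2 / 2) = κ / 2 * (x * s ^ 2) by ring, hsq]; ring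
  have h₄ := mul_le_mul_of_nonneg_left (abs_le.1 h₃).1 hx.le
  have h₅ := mul_le_mul_of_nonneg_left (abs_le.1 h₃).2 hx.le
  constructor
  · refine le_trans ?_ (mul_le_mul_right h₂.1 _)
    rw [← ENNReal.ofReal_mul (Real.exp_nonneg _), ← Real.exp_add]
    refine ENNReal.ofReal_le_ofReal (Real.exp_le_exp.2 ?_)
    linarith
  · refine (mul_le_mul_right h₂.2 _).trans ?_
    rw [← ENNReal.ofReal_mul (Real.exp_nonneg _), ← Real.exp_add]
    refine ENNReal.ofReal_le_ofReal (Real.exp_le_exp.2 ?_)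
    linarith

end Main

theorem proposition3p2 {Ω : Type*} [MeasurableSpace Ω] (P : Measure Ω) [IsProbabilityMeasure P]
    (lam mu : ℝ) (hmu : 0 < mu) (hlam : mu < lam)
    (M : Ω → ℕ) (hM : IsLightTailedCount P M)
    (τ : ℝ → ℕ → ℕ → Ω → ℝ) (hτ : ∀ x : ℝ, 0 < x → IsTelegraphDurations P lam mu M (τ x))
    (A : ℝ → Ω → ℝ) (hA : ∀ x : ℝ, 0 < x → A x = absorptionTimeRV x M (τ x))
    (ε : ℝ → ℝ) (hε_pos : ∀ x : ℝ, 0 < x → 0 < ε x)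
    (hε_zero : Tendsto ε atTop (𝓝 0))
    (hε_top : Tendsto (fun x : ℝ => x * ε x) atTop atTop)
    (I : ℝ → ℝ≥0∞)
    (hI : ∀ z : ℝ, I z =
      ENNReal.ofReal (z ^ 2 / (2 * iteratedDeriv 2 (telegraphLambda lam mu) 0))) :
    (∀ x : ℝ, 0 < x → Integrable (A x) P) ∧
    SatisfiesLDP P (fun x ω => (A x ω - ∫ ω', A x ω' ∂P) / √(x / ε x)) (fun x => 1 / ε x) I ∧
    IsGoodRateFunction I ∧
    iteratedDeriv 2 (telegraphLambda lam mu) 0 = 8 * lam * mu / (lam - mu) ^ 3 := by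
  have hκ := iteratedDeriv_two_telegraphLambda hmu hlam
  have hκ0 : 0 < 8 * lam * mu / (lam - mu) ^ 3 := by
    have := hmu.trans hlam
    have := sub_pos.2 hlam
    positivity
  rw [hκ] at hI
  have hint : ∀ x : ℝ, 0 < x → Integrable (A x) P := fun x hx => by
    rw [hA x hx]; exact integrable_absorptionTimeRV hmu hlam hM (hτ x hx) hx.le
  have hv : Tendsto (fun x => 1 / ε x) atTop atTop := by
    simp_rw [one_div]
    exact (tendsto_nhdsWithin_iff.2
      ⟨hε_zero, (eventually_gt_atTop 0).mono hε_pos⟩).inv_tendsto_nhdsGT_zero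
  refine ⟨hint, ?_, isGoodRateFunction_quadratic hκ0 hI, hκ⟩
  have hq := (hasQuadraticCumulants_absorptionTimeRV hmu hlam hM hτ hε_pos hε_zero
    hε_top).sub_integral hκ0 (fun x hx => by
      rw [← hA x hx]; exact ((hint x hx).sub (integrable_const _)).div_const _) hv
  -- the centering `Λ'(0) x` cancels when the mean is subtracted
  have hq' : HasQuadraticCumulants P (fun x ω => (A x ω - ∫ ω', A x ω' ∂P) / √(x / ε x))
      (fun x => 1 / ε x) (8 * lam * mu / (lam - mu) ^ 3) := by
    intro θ η hη
    filter_upwards [hq θ η hη, eventually_gt_atTop 0] with x hx hx0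
    rw [← hA x hx0, integral_div, integral_sub (hint x hx0) (integrable_const _)] at hx
    simpa [← sub_div] using hx
  exact hq'.satisfiesLDP hκ0 (fun x hx =>
    ((hint x hx).aestronglyMeasurable.aemeasurable.sub_const _).div_const _) hv hI
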